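/- Let $n_x,n_\xi,n_\phi$ be dimensions, let $\phi=(\phi_1,\dots,\phi_{n_\phi})^\top:\mathbb{R}^{n_x}\to\mathbb{R}^{n_\phi}$ be basis functions and let $x\in\mathbb{R}^{n_x}$ with $\phi(x)\neq 0$. Let $\bar M\in\mathbb{R}^{n_\xi\times n_\phi}$, let $\bar V\in\mathbb{R}^{n_\phi\times n_\phi}$ and $\bar\Psi\in\mathbb{R}^{n_\xi\times n_\xi}$ be symmetric positive definite, and let $\bar\nu>n_\xi-1$ be real. Consider the hierarchical model $$\xi\mid A,\Sigma_\epsilon\sim\mathcal N(A\phi(x),\Sigma_\epsilon),\qquad (A,\Sigma_\epsilon)\sim\mathcal{MNIW}(\bar M,\bar V,\bar\Psi,\bar\nu),$$ where $\mathcal{MNIW}$ is the matrix-normal inverse-Wishart probability distribution, with density $\mathcal{MN}(A\mid \bar M,\Sigma_\epsilon,\bar V)\,\mathcal{IW}(\Sigma_\epsilon\mid\bar\Psi,\bar\nu)$ with respect to $\prod_{i,j}dA_{ij}\prod_{i\le j}d(\Sigma_\epsilon)_{ij}$, supported on positive definite $\Sigma_\epsilon$, $$\mathcal{MN}(A\mid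 \bar M,\Sigma_\epsilon,\bar V)=\frac{\exp\left(-\tfrac12\operatorname{Tr}\left((A-\bar M)^\top\Sigma_\epsilon^{-1}(A-\bar M)\bar V^{-1}\right)\right)}{(2\pi)^{n_\xi n_\phi/2}|\bar V|^{n_\xi/2}|\Sigma_\epsilon|^{n_\phi/2}},$$ $$\mathcal{IW}(\Sigma_\epsilon\mid\bar\Psi,\bar\nu)=\frac{|\bar\Psi|^{\bar\nu/2}|\Sigma_\epsilon|^{-(n_\xi+\bar\nu+1)/2}}{2^{\bar\nu n_\xi/2}\,\Gamma_{n_\xi}(\bar\nu/2)}\exp\left(-\tfrac12\operatorname{Tr}(\Sigma_\epsilon^{-1}\bar\Psi)\right),$$ and $\Gamma_{p}(a)=\pi^{p(p-1)/4}\prod_{j=1}^{p}\Gamma\left(a+\tfrac{1-j}{2}\right)$ is the multivariate gamma function. Then the marginal (predictive) distribution of $\xi$ is the multivariate Student-t distribution $\mathcal T(\bar\rho,\bar\mu,\bar\Lambda)$ with $$\bar\rho=\bar\nu-n_\xi+1,\qquad \bar\mu=\bar M\phi(x),\qquad \bar\Lambda=\frac{\bar\kappa+1}{\bar\kappa\,\bar\rho}\,\bar\Psi,\qquad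 \bar\kappa=\frac{1}{\phi(x)^\top\bar V\phi(x)};$$ that is, for every $\xi\in\mathbb{R}^{n_\xi}$, $$\int \mathcal N(\xi\mid A\phi(x),\Sigma_\epsilon)\,\mathcal{MNIW}(A,\Sigma_\epsilon\mid\bar M,\bar V,\bar\Psi,\bar\nu)\,d(A,\Sigma_\epsilon)=\frac{\Gamma\left(\frac{\bar\rho+n_\xi}{2}\right)}{\Gamma\left(\frac{\bar\rho}{2}\right)(\bar\rho\pi)^{n_\xi/2}|\bar\Lambda|^{1/2}}\left(1+\frac1{\bar\rho}(\xi-\bar\mu)^\top\bar\Lambda^{-1}(\xi-\bar\mu)\right)^{-(\bar\rho+n_\xi)/2}.$$ If $\bar\rho>1$, the location $\bar\mu$ is the mean of this distribution. -/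

import Mathlib

open MeasureTheory ProbabilityTheory Matrix

noncomputable section

/-- The Borel (product) σ-algebra on real matrices. -/
instance Matrix.instMeasurableSpaceReal {m n : ℕ} :
    MeasurableSpace (Matrix (Fin m) (Fin n) ℝ) :=
  inferInstanceAs (MeasurableSpace (Fin m → Fin n → ℝ))

/-- Lebesgue measure `∏ i j, d a_ij` on real `m × n` matrices. -/
def matrixLebesgue (m n : ℕ) : Measure (Matrix (Fin m) (Fin n) ℝ) :=
  (volume : Measure (Fin m → Fin n → ℝ)).map Matrix.of

/-- The symmetric matrix with prescribed entries on and above the diagonal. -/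
def symOfUpper {n : ℕ} (v : {p : Fin n × Fin n // p.1 ≤ p.2} → ℝ) :
    Matrix (Fin n) (Fin n) ℝ :=
  Matrix.of fun i j => v ⟨(min i j, max i j), min_le_max⟩

/-- Lebesgue measure `∏ i ≤ j, d s_ij` on real symmetric `n × n` matrices, as a measure on all
matrices that is concentrated on the symmetric ones. -/
def symLebesgue (n : ℕ) : Measure (Matrix (Fin n) (Fin n) ℝ) :=
  (volume : Measure ({p : Fin n × Fin n // p.1 ≤ p.2} → ℝ)).map symOfUpper

/-- The multivariate gamma function
`Γ_p(a) = π ^ (p (p - 1) / 4) ∏_{j = 1}^{p} Γ(a + (1 - j) / 2)`. -/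
def multivariateGamma (p : ℕ) (a : ℝ) : ℝ :=
  Real.pi ^ ((p : ℝ) * ((p : ℝ) - 1) / 4) *
    ∏ j ∈ Finset.Icc 1 p, Real.Gamma (a + (1 - (j : ℝ)) / 2)

/-- Density of the multivariate normal distribution `N(m, S)`, `S` positive definite. -/
def normalPDF {p : ℕ} (m : EuclideanSpace ℝ (Fin p)) (S : Matrix (Fin p) (Fin p) ℝ)
    (z : EuclideanSpace ℝ (Fin p)) : ℝ :=
  1 / ((2 * Real.pi) ^ ((p : ℝ) / 2) * S.det ^ (1 / 2 : ℝ)) *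
    Real.exp (-(1 / 2) * ((z - m).ofLp ⬝ᵥ (S⁻¹ *ᵥ (z - m).ofLp)))

/-- Density of the matrix normal distribution with mean `M`, row covariance `S`, column
covariance `V`. -/
def matrixNormalPDF {p q : ℕ} (M : Matrix (Fin p) (Fin q) ℝ) (S : Matrix (Fin p) (Fin p) ℝ)
    (V : Matrix (Fin q) (Fin q) ℝ) (A : Matrix (Fin p) (Fin q) ℝ) : ℝ :=
  1 / ((2 * Real.pi) ^ ((p : ℝ) * (q : ℝ) / 2) * V.det ^ ((p : ℝ) / 2) *
      S.det ^ ((q : ℝ) / 2)) *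
    Real.exp (-(1 / 2) * ((A - M)ᵀ * S⁻¹ * (A - M) * V⁻¹).trace)

open scoped Classical in
/-- Density of the inverse Wishart distribution with scale matrix `Ψ` and `ν` degrees of freedom;
it is supported on the positive definite matrices. -/
def inverseWishartPDF {p : ℕ} (Ψ : Matrix (Fin p) (Fin p) ℝ) (ν : ℝ)
    (S : Matrix (Fin p) (Fin p) ℝ) : ℝ :=
  if S.PosDef then
    Ψ.det ^ (ν / 2) * S.det ^ (-((p : ℝ) + ν + 1) / 2) /
        (2 ^ (ν * (p : ℝ) / 2) * multivariateGamma p (ν / 2)) *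
      Real.exp (-(1 / 2) * (S⁻¹ * Ψ).trace)
  else 0

/-- Density of the matrix-normal inverse-Wishart distribution at `θ = (A, Σ)`. -/
def mniwPDF {p q : ℕ} (M : Matrix (Fin p) (Fin q) ℝ) (V : Matrix (Fin q) (Fin q) ℝ)
    (Ψ : Matrix (Fin p) (Fin p) ℝ) (ν : ℝ)
    (θ : Matrix (Fin p) (Fin q) ℝ × Matrix (Fin p) (Fin p) ℝ) : ℝ :=
  matrixNormalPDF M θ.2 V θ.1 * inverseWishartPDF Ψ ν θ.2

/-- The reference measure `dA dΣ` on the parameters `θ = (A, Σ)`. -/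
def paramLebesgue (p q : ℕ) :
    Measure (Matrix (Fin p) (Fin q) ℝ × Matrix (Fin p) (Fin p) ℝ) :=
  (matrixLebesgue p q).prod (symLebesgue p)

/-- The matrix-normal inverse-Wishart distribution. -/
def mniw {p q : ℕ} (M : Matrix (Fin p) (Fin q) ℝ) (V : Matrix (Fin q) (Fin q) ℝ)
    (Ψ : Matrix (Fin p) (Fin p) ℝ) (ν : ℝ) :
    Measure (Matrix (Fin p) (Fin q) ℝ × Matrix (Fin p) (Fin p) ℝ) :=
  (paramLebesgue p q).withDensity fun θ => ENNReal.ofReal (mniwPDF M V Ψ ν θ)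

/-- Density of the multivariate Student-t distribution with `ρ` degrees of freedom, location `μ`
and scale matrix `Λ`. -/
def studentTPDF {p : ℕ} (ρ : ℝ) (μ : EuclideanSpace ℝ (Fin p)) (Λ : Matrix (Fin p) (Fin p) ℝ)
    (z : EuclideanSpace ℝ (Fin p)) : ℝ :=
  Real.Gamma ((ρ + (p : ℝ)) / 2) /
      (Real.Gamma (ρ / 2) * ρ ^ ((p : ℝ) / 2) * Real.pi ^ ((p : ℝ) / 2) *
        Λ.det ^ (1 / 2 : ℝ)) *
    (1 + (1 / ρ) * ((z - μ).ofLp ⬝ᵥ (Λ⁻¹ *ᵥ (z - μ).ofLp))) ^ (-(ρ + (p : ℝ)) / 2)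

/-- The multivariate Student-t distribution. -/
def studentT {p : ℕ} (ρ : ℝ) (μ : EuclideanSpace ℝ (Fin p)) (Λ : Matrix (Fin p) (Fin p) ℝ) :
    Measure (EuclideanSpace ℝ (Fin p)) :=
  volume.withDensity fun z => ENNReal.ofReal (studentTPDF ρ μ Λ z)

/-- The vector `(φ₁(x), …, φ_q(x))` of basis function values. -/
def basisVec {q d : ℕ} (φ : Fin q → EuclideanSpace ℝ (Fin d) → ℝ)
    (x : EuclideanSpace ℝ (Fin d)) : Fin q → ℝ :=
  fun i => φ i x

/-- The density `p(ξ | x) = ∫ N(ξ | A φ(x), Σ) MNIW(A, Σ | M, V, Ψ, ν) dA dΣ` of `ξ` after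
marginalizing the parameters; `b` stands for `φ(x)`. -/
def predictivePDF {p q : ℕ} (M : Matrix (Fin p) (Fin q) ℝ) (V : Matrix (Fin q) (Fin q) ℝ)
    (Ψ : Matrix (Fin p) (Fin p) ℝ) (ν : ℝ) (b : Fin q → ℝ) (ξ : EuclideanSpace ℝ (Fin p)) : ℝ :=
  ∫ θ, normalPDF (WithLp.toLp 2 (θ.1 *ᵥ b)) θ.2 ξ * mniwPDF M V Ψ ν θ ∂(paramLebesgue p q)

/-- The law of `ξ` in the hierarchical model `(A, Σ) ~ MNIW(M, V, Ψ, ν)`,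
`ξ | A, Σ ~ N(A φ(x), Σ)`; `b` stands for `φ(x)`. -/
def predictiveLaw {p q : ℕ} (M : Matrix (Fin p) (Fin q) ℝ) (V : Matrix (Fin q) (Fin q) ℝ)
    (Ψ : Matrix (Fin p) (Fin p) ℝ) (ν : ℝ) (b : Fin q → ℝ) :
    Measure (EuclideanSpace ℝ (Fin p)) :=
  (mniw M V Ψ ν).bind fun θ => multivariateGaussian (WithLp.toLp 2 (θ.1 *ᵥ b)) θ.2

end

/-!
The parameters are integrated out one after the other, `A` first and then `Σ`, with all integrals
taken as lower Lebesgue integrals so that Tonelli's theorem applies without integrability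
conditions. Write `b = φ(x)`, `c = 1 + bᵀ V b` and `r = ξ - M b`.

*Integrating out `A`.* For fixed `Σ` the exponent of `N(ξ | A b, Σ) MN(A | M, Σ, V)` is a quadratic
polynomial in `A`. Completing the square (`quadForm_add_trace`) turns it into a matrix normal
exponent with column precision `V⁻¹ + b bᵀ` plus the remainder `c⁻¹ rᵀ Σ⁻¹ r`. The matrix normal
integral (`lintegral_exp_neg_trace`) is a Gaussian integral over the entries with covariance
`V ⊗ Σ`. What remains is the density of `N(M b, c Σ)`
(`lintegral_normalPDF_mul_matrixNormalPDF`).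

*Integrating out `Σ`.* Multiplied by this normal density, the inverse Wishart density with
parameters `Ψ, ν` becomes an inverse Wishart kernel with parameters `Ψ + c⁻¹ r rᵀ, ν + 1`. The
Student-t density is therefore a quotient of two inverse Wishart normalizing constants: the matrix
determinant lemma gives `|Ψ + c⁻¹ r rᵀ| = |Ψ| (1 + c⁻¹ rᵀ Ψ⁻¹ r)`, and the multivariate gamma
functions telescope (`multivariateGamma_add_half`).

*The inverse Wishart constant* (`lintegral_inverseWishartKernel`) is found by induction on the
dimension. A positive definite matrix is determined by its lower right block `D`, the regression
vector `w` and the Schur complement `u > 0` of `D`, its first row being `(u + wᵀ D w, D w)`; this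
substitution has Jacobian `|D|`. In these coordinates the determinant is `u |D|`, and if `Ψ` is
written likewise with `F, v, a` in place of `D, w, u`, then
`tr(Σ⁻¹ Ψ) = u⁻¹ (a + (w - v)ᵀ F (w - v)) + tr(D⁻¹ F)` (`trace_inv_bordered_mul`). So
the integral over `w` is Gaussian, the one over `u` is an inverse gamma integral, and the one over
`D` is the same problem in one dimension less.

*The law and its mean.* On positive definite `Σ`, which carry the prior, the Gaussian measure has
the normal density, and Tonelli's theorem identifies the law of `ξ` with the measure whose density
was computed. For `ρ > 1` the Student-t density decays fast enough for the mean to exist, and the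
density is symmetric about `μ`.
-/

noncomputable section

/-! ### The density of a nondegenerate Gaussian distribution -/

/-- The standard Gaussian distribution has density `(2π)^{-n/2} exp(-‖v‖²/2)`; both measures have
the same characteristic function. -/
theorem stdGaussian_eq_withDensity (E : Type*) [NormedAddCommGroup E] [InnerProductSpace ℝ E]
    [FiniteDimensional ℝ E] [MeasurableSpace E] [BorelSpace E] :
    stdGaussian E = (volume : Measure E).withDensity fun v => ENNReal.ofReal
      (((2 * Real.pi) ^ ((Module.finrank ℝ E : ℝ) / 2))⁻¹ * Real.exp (-(1 / 2) * ‖v‖ ^ 2)) := by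
  have hint : Integrable (fun v : E => Real.exp (-(1 / 2) * ‖v‖ ^ 2)) := by
    have h := GaussianFourier.integrable_cexp_neg_mul_sq_norm_add (V := E) (b := (1 / 2 : ℂ))
      (by norm_num) 0 0
    refine h.norm.congr (.of_forall fun v => ?_)
    simp [Complex.norm_exp, ← Complex.ofReal_pow]
  have hint' := hint.const_mul ((2 * Real.pi) ^ ((Module.finrank ℝ E : ℝ) / 2))⁻¹
  have : IsFiniteMeasure ((volume : Measure E).withDensity fun v => ENNReal.ofReal
      (((2 * Real.pi) ^ ((Module.finrank ℝ E : ℝ) / 2))⁻¹ * Real.exp (-(1 / 2) * ‖v‖ ^ 2))) :=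
    isFiniteMeasure_withDensity_ofReal hint'.2
  refine Measure.ext_of_charFun (funext fun t => ?_)
  rw [charFun_stdGaussian, charFun_apply, integral_withDensity_eq_integral_toReal_smul
    (by fun_prop) (by simp)]
  have h := GaussianFourier.integral_cexp_neg_mul_sq_norm_add (V := E) (b := (1 / 2 : ℂ))
    (by norm_num) Complex.I t
  have h2 : ∀ v : E, (ENNReal.ofReal (((2 * Real.pi) ^ ((Module.finrank ℝ E : ℝ) / 2))⁻¹ *
      Real.exp (-(1 / 2) * ‖v‖ ^ 2))).toReal • Complex.exp ((inner ℝ v t : ℝ) * Complex.I) =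
      (((2 * Real.pi) ^ ((Module.finrank ℝ E : ℝ) / 2))⁻¹ : ℝ) *
        Complex.exp (-(1 / 2 : ℂ) * ‖v‖ ^ 2 + Complex.I * (inner ℝ t v : ℝ)) := by
    intro v
    rw [ENNReal.toReal_ofReal (by positivity), Complex.real_smul, real_inner_comm, Complex.exp_add]
    push_cast
    rw [mul_comm Complex.I, mul_assoc]
  simp_rw [h2]
  rw [integral_const_mul, h, ← mul_assoc]
  have h3 : ((Real.pi : ℂ) / (1 / 2)) ^ ((Module.finrank ℝ E : ℂ) / 2) =
      (((2 * Real.pi) ^ ((Module.finrank ℝ E : ℝ) / 2) : ℝ) : ℂ) := by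
    rw [Complex.ofReal_cpow (by positivity)]
    push_cast
    congr 1
    ring
  rw [h3, ← Complex.ofReal_mul, inv_mul_cancel₀ (by positivity), Complex.ofReal_one, one_mul]
  congr 1
  rw [Complex.I_sq]
  ring

variable {ι : Type*} [Fintype ι] [DecidableEq ι]

theorem lintegral_comp_mulVec {R : Matrix ι ι ℝ} (hR : R.det ≠ 0) {f : (ι → ℝ) → ENNReal}
    (hf : Measurable f) :
    ∫⁻ x, f (R *ᵥ x) = ENNReal.ofReal |R.det⁻¹| * ∫⁻ x, f x := by
  have h := Real.map_matrix_volume_pi_eq_smul_volume_pi hR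
  rw [← smul_eq_mul, ← lintegral_smul_measure, ← h, lintegral_map hf]
  · rfl
  · exact (LinearMap.continuous_of_finiteDimensional _).measurable

/-- The density at `z` of the centred normal distribution with positive definite covariance `S`
on `ι → ℝ`. -/
def centredNormalPDF (S : Matrix ι ι ℝ) (z : ι → ℝ) : ℝ :=
  1 / ((2 * Real.pi) ^ ((Fintype.card ι : ℝ) / 2) * S.det ^ (1 / 2 : ℝ)) *
    Real.exp (-(1 / 2) * (z ⬝ᵥ (S⁻¹ *ᵥ z)))

theorem measurable_centredNormalPDF (S : Matrix ι ι ℝ) : Measurable (centredNormalPDF S) := by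
  unfold centredNormalPDF
  have : Continuous fun z : ι → ℝ => z ⬝ᵥ (S⁻¹ *ᵥ z) := by fun_prop
  fun_prop

open scoped MatrixOrder in
theorem Matrix.PosDef.sqrt_spec {S : Matrix ι ι ℝ} (hS : S.PosDef) :
    (CFC.sqrt S)ᵀ = CFC.sqrt S ∧ CFC.sqrt S * CFC.sqrt S = S ∧ IsUnit (CFC.sqrt S).det := by
  have hRR := CFC.sqrt_mul_sqrt_self S hS.posSemidef.nonneg
  refine ⟨?_, hRR, isUnit_iff_ne_zero.2 fun h => hS.det_pos.ne' ?_⟩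
  · have := (CFC.sqrt_nonneg S).posSemidef.1
    simpa [IsHermitian, conjTranspose_eq_transpose_of_trivial] using this
  · rw [← hRR, det_mul, h, zero_mul]

open scoped MatrixOrder in
/-- A nondegenerate Gaussian is the image of the standard one under `x ↦ m + S^{1/2} x`, so its
density comes from a linear change of variables. -/
theorem multivariateGaussian_eq_withDensity (m : EuclideanSpace ℝ ι) {S : Matrix ι ι ℝ}
    (hS : S.PosDef) :
    multivariateGaussian m S =
      volume.withDensity fun z => ENNReal.ofReal (centredNormalPDF S (z - m).ofLp) := by
  obtain ⟨hsymm, hRR, hRu⟩ := hS.sqrt_spec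
  set R := CFC.sqrt S with hR
  have hdet : R.det * R.det = S.det := by rw [← det_mul, hRR]
  have hR0 : R.det ≠ 0 := hRu.ne_zero
  have habs : S.det ^ (1 / 2 : ℝ) = |R.det| := by
    rw [← hdet, ← Real.sqrt_eq_rpow, Real.sqrt_mul_self_eq_abs]
  have hmeas := measurable_centredNormalPDF S
  refine Measure.ext_of_lintegral _ fun f hf => ?_
  rw [multivariateGaussian, lintegral_map hf (by fun_prop), stdGaussian_eq_withDensity,
    lintegral_withDensity_eq_lintegral_mul _ (by fun_prop) (by fun_prop),
    lintegral_withDensity_eq_lintegral_mul _ (by fun_prop) hf,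
    ← (PiLp.volume_preserving_toLp ι).lintegral_comp (by fun_prop),
    ← (PiLp.volume_preserving_toLp ι).lintegral_comp (by fun_prop)]
  conv_rhs => rw [← lintegral_add_left_eq_self _ m.ofLp]
  have key : ∀ x : ι → ℝ, ((2 * Real.pi) ^ ((Fintype.card ι : ℝ) / 2))⁻¹ *
      Real.exp (-(1 / 2) * ‖WithLp.toLp 2 x‖ ^ 2) = |R.det| * centredNormalPDF S (R *ᵥ x) := by
    intro x
    have h1 : (R *ᵥ x) ⬝ᵥ (S⁻¹ *ᵥ (R *ᵥ x)) = x ⬝ᵥ x := by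
      rw [← hRR, Matrix.mul_inv_rev, mulVec_mulVec, mul_assoc, nonsing_inv_mul _ hRu, mul_one,
        dotProduct_mulVec, ← vecMul_transpose, vecMul_vecMul, hsymm, mul_nonsing_inv _ hRu,
        vecMul_one]
    rw [centredNormalPDF, h1, habs, EuclideanSpace.real_norm_sq_eq]
    have h2 : x ⬝ᵥ x = ∑ i, x i ^ 2 := by simp [dotProduct, sq]
    rw [h2]
    have := abs_pos.2 hR0
    field_simp
  have h3 := lintegral_comp_mulVec hR0 (f := fun y =>
    ENNReal.ofReal (|R.det| * centredNormalPDF S y) * f (m + WithLp.toLp 2 y)) (by fun_prop)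
  have h4 : ∀ x : ι → ℝ, m + toEuclideanCLM (𝕜 := ℝ) R (WithLp.toLp 2 x) =
      m + WithLp.toLp 2 (R *ᵥ x) := fun x => by rw [toEuclideanCLM_toLp]
  simp only [Pi.mul_apply, finrank_euclideanSpace, key, ← hR, h4]
  rw [h3, ← lintegral_const_mul _ (by fun_prop)]
  refine lintegral_congr fun y => ?_
  rw [← mul_assoc, ← ENNReal.ofReal_mul (abs_nonneg _), ← mul_assoc, ← abs_mul,
    inv_mul_cancel₀ hR0, abs_one, one_mul, WithLp.toLp_add, WithLp.toLp_ofLp, add_sub_cancel_left]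

theorem lintegral_centredNormalPDF {S : Matrix ι ι ℝ} (hS : S.PosDef) :
    ∫⁻ z, ENNReal.ofReal (centredNormalPDF S z) = 1 := by
  have h : multivariateGaussian 0 S Set.univ = 1 := measure_univ
  rw [multivariateGaussian_eq_withDensity 0 hS, withDensity_apply _ .univ,
    Measure.restrict_univ] at h
  have := measurable_centredNormalPDF S
  rw [← h, ← (PiLp.volume_preserving_toLp ι).lintegral_comp (by fun_prop)]
  simp

/-- The Gaussian integral of a positive definite quadratic form. -/
theorem lintegral_exp_neg_quadForm {S : Matrix ι ι ℝ} (hS : S.PosDef) :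
    ∫⁻ z, ENNReal.ofReal (Real.exp (-(1 / 2) * (z ⬝ᵥ (S⁻¹ *ᵥ z)))) =
      ENNReal.ofReal ((2 * Real.pi) ^ ((Fintype.card ι : ℝ) / 2) * S.det ^ (1 / 2 : ℝ)) := by
  have h := lintegral_centredNormalPDF hS
  have := hS.det_pos
  set c := (2 * Real.pi) ^ ((Fintype.card ι : ℝ) / 2) * S.det ^ (1 / 2 : ℝ) with hc
  have hc0 : 0 < c := by positivity
  simp only [centredNormalPDF, ← hc] at h
  have h2 : ∀ z : ι → ℝ, Real.exp (-(1 / 2) * (z ⬝ᵥ (S⁻¹ *ᵥ z))) =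
      c * (1 / c * Real.exp (-(1 / 2) * (z ⬝ᵥ (S⁻¹ *ᵥ z)))) := fun z => by field_simp
  have hm : Continuous fun z : ι → ℝ => z ⬝ᵥ (S⁻¹ *ᵥ z) := by fun_prop
  rw [lintegral_congr fun z => by rw [h2 z, ENNReal.ofReal_mul hc0.le],
    lintegral_const_mul _ (by fun_prop), h, mul_one]

/-! ### Measurability on spaces of matrices -/

instance Matrix.instBorelSpaceReal {m n : ℕ} : BorelSpace (Matrix (Fin m) (Fin n) ℝ) :=
  inferInstanceAs (BorelSpace (Fin m → Fin n → ℝ))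

instance Matrix.instSecondCountableTopologyReal {m n : ℕ} :
    SecondCountableTopology (Matrix (Fin m) (Fin n) ℝ) :=
  inferInstanceAs (SecondCountableTopology (Fin m → Fin n → ℝ))

theorem measurable_matrix_det {n : ℕ} :
    Measurable fun S : Matrix (Fin n) (Fin n) ℝ => S.det :=
  (Continuous.matrix_det continuous_id).measurable

theorem measurable_matrix_of_entries {α : Type*} [MeasurableSpace α] {m n : ℕ}
    {f : α → Matrix (Fin m) (Fin n) ℝ} (h : ∀ i j, Measurable fun a => f a i j) : Measurable f :=
  measurable_pi_lambda (X := fun _ : Fin m => Fin n → ℝ) f fun i =>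
    measurable_pi_lambda _ fun j => h i j

theorem measurable_matrix_inv {n : ℕ} :
    Measurable fun S : Matrix (Fin n) (Fin n) ℝ => S⁻¹ := by
  refine measurable_matrix_of_entries fun i j => ?_
  simp only [Matrix.inv_def, Ring.inverse_eq_inv', Matrix.smul_apply, smul_eq_mul]
  refine measurable_matrix_det.inv.mul (Continuous.measurable ?_)
  exact (Continuous.matrix_adjugate continuous_id).matrix_elem i j

/-- Positive definite means positive semidefinite, a closed condition, with nonzero determinant. -/
theorem measurableSet_posDef {n : ℕ} :
    MeasurableSet {S : Matrix (Fin n) (Fin n) ℝ | S.PosDef} := by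
  have h : {S : Matrix (Fin n) (Fin n) ℝ | S.PosDef} =
      ({S | Sᴴ = S} ∩ ⋂ x : Fin n → ℝ, {S | 0 ≤ star x ⬝ᵥ (S *ᵥ x)}) ∩ {S | S.det ≠ 0} := by
    ext S
    simp only [Set.mem_inter_iff, Set.mem_ofPred_eq, Set.mem_iInter]
    constructor
    · exact fun h => ⟨⟨h.1, fun x => (posSemidef_iff_dotProduct_mulVec.1 h.posSemidef).2 x⟩,
        h.det_pos.ne'⟩
    · exact fun h => (posSemidef_iff_dotProduct_mulVec.2 h.1).posDef_iff_det_ne_zero.2 h.2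
  rw [h]
  refine MeasurableSet.inter (IsClosed.inter ?_ (isClosed_iInter fun x => ?_)).measurableSet
    (measurable_matrix_det (measurableSet_singleton 0).compl)
  · exact isClosed_eq (Continuous.matrix_conjTranspose continuous_id) continuous_id
  · exact isClosed_le continuous_const (by fun_prop)

instance {m n : ℕ} : SFinite (matrixLebesgue m n) := by
  unfold matrixLebesgue; infer_instance

instance {n : ℕ} : SFinite (symLebesgue n) := by
  unfold symLebesgue; infer_instance

/-! ### Bordered symmetric matrices -/

/-- The index `0` split off from the others and put last. -/
def finSuccEquivSum (n : ℕ) : Fin (n + 1) ≃ Fin n ⊕ Unit :=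
  (finSuccEquiv n).trans (Equiv.optionEquivSumPUnit (Fin n))

@[simp] theorem finSuccEquivSum_zero (n : ℕ) : finSuccEquivSum n 0 = Sum.inr () := by
  simp [finSuccEquivSum]

@[simp] theorem finSuccEquivSum_succ {n : ℕ} (i : Fin n) :
    finSuccEquivSum n i.succ = Sum.inl i := by
  simp [finSuccEquivSum]

/-- The symmetric matrix with first row `(t, s)` and lower right block `D`. -/
def bordered {n : ℕ} (t : ℝ) (s : Fin n → ℝ) (D : Matrix (Fin n) (Fin n) ℝ) :
    Matrix (Fin (n + 1)) (Fin (n + 1)) ℝ :=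
  (fromBlocks D (replicateCol Unit s) (replicateCol Unit s)ᴴ (of fun _ _ => t)).submatrix
    (finSuccEquivSum n) (finSuccEquivSum n)

variable {n : ℕ}

@[simp] theorem bordered_zero_zero (t : ℝ) (s : Fin n → ℝ) (D : Matrix (Fin n) (Fin n) ℝ) :
    bordered t s D 0 0 = t := by simp [bordered]

@[simp] theorem bordered_zero_succ (t : ℝ) (s : Fin n → ℝ) (D : Matrix (Fin n) (Fin n) ℝ)
    (j : Fin n) : bordered t s D 0 j.succ = s j := by simp [bordered]

@[simp] theorem bordered_succ_zero (t : ℝ) (s : Fin n → ℝ) (D : Matrix (Fin n) (Fin n) ℝ)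
    (i : Fin n) : bordered t s D i.succ 0 = s i := by simp [bordered]

@[simp] theorem bordered_succ_succ (t : ℝ) (s : Fin n → ℝ) (D : Matrix (Fin n) (Fin n) ℝ)
    (i j : Fin n) : bordered t s D i.succ j.succ = D i j := by simp [bordered]

theorem measurable_bordered :
    Measurable fun x : Matrix (Fin n) (Fin n) ℝ × (Fin n → ℝ) × ℝ =>
      bordered x.2.2 x.2.1 x.1 := by
  refine measurable_matrix_of_entries fun i j => Continuous.measurable ?_
  refine Fin.cases ?_ (fun i => ?_) i <;> refine Fin.cases ?_ (fun j => ?_) j <;>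
    simp only [bordered_zero_zero, bordered_zero_succ, bordered_succ_zero, bordered_succ_succ] <;>
    fun_prop

/-- Every positive definite matrix is a bordered matrix, in the coordinates given by
the Schur complement `u` and the regression vector `w`. -/
theorem exists_eq_bordered {S : Matrix (Fin (n + 1)) (Fin (n + 1)) ℝ} (hS : S.PosDef) :
    ∃ (u : ℝ) (w : Fin n → ℝ) (D : Matrix (Fin n) (Fin n) ℝ), D.PosDef ∧
      S = bordered (u + w ⬝ᵥ (D *ᵥ w)) (D *ᵥ w) D := by
  have hD := hS.submatrix (Fin.succ_injective n)
  set D := S.submatrix Fin.succ Fin.succ with hDdef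
  let s : Fin n → ℝ := fun i => S i.succ 0
  have hs : D *ᵥ (D⁻¹ *ᵥ s) = s := by
    rw [mulVec_mulVec, mul_nonsing_inv _ hD.det_pos.ne'.isUnit, one_mulVec]
  refine ⟨S 0 0 - (D⁻¹ *ᵥ s) ⬝ᵥ s, D⁻¹ *ᵥ s, D, hD, ?_⟩
  rw [hs, sub_add_cancel]
  ext i j
  refine Fin.cases ?_ (fun i => ?_) i <;> refine Fin.cases ?_ (fun j => ?_) j
  · simp
  · simpa [s] using hS.1.apply j.succ 0
  · simp [s]
  · simp [hDdef]

theorem posDef_of_posDef_bordered {t : ℝ} {s : Fin n → ℝ} {D : Matrix (Fin n) (Fin n) ℝ}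
    (h : (bordered t s D).PosDef) : D.PosDef := by
  have := h.submatrix (Fin.succ_injective n)
  convert this
  ext i j
  simp

theorem det_bordered (u : ℝ) (w : Fin n → ℝ) {D : Matrix (Fin n) (Fin n) ℝ} (hD : D.PosDef) :
    (bordered (u + w ⬝ᵥ (D *ᵥ w)) (D *ᵥ w) D).det = u * D.det := by
  have hu := hD.det_pos.ne'.isUnit
  have hT : Dᵀ = D := by simpa [IsHermitian] using hD.1
  let _ := invertibleOfIsUnitDet D hu
  rw [bordered, det_submatrix_equiv_self, det_fromBlocks₁₁, mul_comm]
  congr 1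
  rw [det_unique]
  simp only [Matrix.sub_apply, of_apply, invOf_eq_nonsing_inv]
  have : ((replicateCol Unit (D *ᵥ w))ᴴ * D⁻¹ * replicateCol Unit (D *ᵥ w)) default default =
      w ⬝ᵥ (D *ᵥ w) := by
    have h1 : D⁻¹ * replicateCol Unit (D *ᵥ w) = replicateCol Unit w := by
      rw [replicateCol_mulVec, nonsing_inv_mul_cancel_left _ _ hu]
    rw [Matrix.mul_assoc, h1]
    simp [mul_apply, dotProduct, mul_comm]
  rw [this]
  ring

theorem posDef_bordered_iff (u : ℝ) (w : Fin n → ℝ) {D : Matrix (Fin n) (Fin n) ℝ}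
    (hD : D.PosDef) : (bordered (u + w ⬝ᵥ (D *ᵥ w)) (D *ᵥ w) D).PosDef ↔ 0 < u := by
  have hdet := hD.det_pos
  have hu := hdet.ne'.isUnit
  refine ⟨fun h => ?_, fun h => ?_⟩
  · have := h.det_pos
    rw [det_bordered u w hD] at this
    exact pos_of_mul_pos_left this hdet.le
  · let _ := invertibleOfIsUnitDet D hu
    have hps : (bordered (u + w ⬝ᵥ (D *ᵥ w)) (D *ᵥ w) D).PosSemidef := by
      rw [bordered, posSemidef_submatrix_equiv, PosDef.fromBlocks₁₁ _ _ hD]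
      have h1 : D⁻¹ * replicateCol Unit (D *ᵥ w) = replicateCol Unit w := by
        rw [replicateCol_mulVec, nonsing_inv_mul_cancel_left _ _ hu]
      rw [Matrix.mul_assoc, h1]
      have h2 : (of fun _ _ : Unit => u + w ⬝ᵥ (D *ᵥ w)) -
          (replicateCol Unit (D *ᵥ w))ᴴ * replicateCol Unit w = u • (1 : Matrix Unit Unit ℝ) := by
        ext i j
        simp [mul_apply, dotProduct, mul_comm]
      rw [h2]
      exact PosSemidef.one.smul h.le
    rw [hps.posDef_iff_det_ne_zero, det_bordered u w hD]
    positivity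

/-- Block inversion: in Schur complement coordinates the inverse has first row `u⁻¹ (1, -wᵀ)` and
lower right block `D⁻¹ + u⁻¹ w wᵀ`. -/
theorem inv_bordered {u : ℝ} (hu : u ≠ 0) (w : Fin n → ℝ) {D : Matrix (Fin n) (Fin n) ℝ}
    (hD : D.PosDef) :
    (bordered (u + w ⬝ᵥ (D *ᵥ w)) (D *ᵥ w) D)⁻¹ =
      bordered u⁻¹ (-u⁻¹ • w) (D⁻¹ + u⁻¹ • vecMulVec w w) := by
  have hT : Dᵀ = D := by simpa [IsHermitian] using hD.1
  have hDu := hD.det_pos.ne'.isUnit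
  have hDi : ∀ i j, ∑ k, D i k * D⁻¹ k j = (1 : Matrix _ _ ℝ) i j := fun i j => by
    rw [← mul_nonsing_inv _ hDu, mul_apply]
  have hwi : ∀ j, ∑ k, (D *ᵥ w) k * D⁻¹ k j = w j := fun j => by
    have : (D *ᵥ w) ᵥ* D⁻¹ = w := by
      rw [← vecMul_transpose, hT, vecMul_vecMul, mul_nonsing_inv _ hDu, vecMul_one]
    exact congrFun this j
  refine inv_eq_right_inv ?_
  ext i j
  rw [mul_apply, Fin.sum_univ_succ]
  refine Fin.cases ?_ (fun i => ?_) i <;> refine Fin.cases ?_ (fun j => ?_) j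
  · simp only [bordered_zero_zero, bordered_zero_succ, bordered_succ_zero, Pi.smul_apply,
      smul_eq_mul, one_apply_eq]
    have : ∑ k, (D *ᵥ w) k * (-u⁻¹ * w k) = -u⁻¹ * (w ⬝ᵥ (D *ᵥ w)) := by
      rw [dotProduct, Finset.mul_sum]
      exact Finset.sum_congr rfl fun k _ => by ring
    rw [this]
    field_simp
    ring
  · simp only [bordered_zero_zero, bordered_zero_succ, bordered_succ_succ, Pi.smul_apply,
      smul_eq_mul, Matrix.add_apply, Matrix.smul_apply, vecMulVec_apply, mul_add,
      Finset.sum_add_distrib, hwi]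
    have : ∑ k, (D *ᵥ w) k * (u⁻¹ * (w k * w j)) = u⁻¹ * (w ⬝ᵥ (D *ᵥ w)) * w j := by
      rw [dotProduct, Finset.mul_sum, Finset.sum_mul]
      exact Finset.sum_congr rfl fun k _ => by ring
    rw [this, one_apply_ne (Fin.succ_ne_zero j).symm]
    field_simp
    ring
  · simp only [bordered_zero_zero, bordered_succ_zero, bordered_succ_succ, Pi.smul_apply,
      smul_eq_mul]
    have : ∑ k, D i k * (-u⁻¹ * w k) = -u⁻¹ * (D *ᵥ w) i := by
      rw [mulVec, dotProduct, Finset.mul_sum]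
      exact Finset.sum_congr rfl fun k _ => by ring
    rw [this, one_apply_ne (Fin.succ_ne_zero i)]
    ring
  · simp only [bordered_zero_succ, bordered_succ_zero, bordered_succ_succ, Pi.smul_apply,
      smul_eq_mul, Matrix.add_apply, Matrix.smul_apply, vecMulVec_apply, mul_add,
      Finset.sum_add_distrib, hDi]
    have : ∑ k, D i k * (u⁻¹ * (w k * w j)) = u⁻¹ * (D *ᵥ w) i * w j := by
      rw [mulVec, dotProduct, Finset.mul_sum, Finset.sum_mul]
      exact Finset.sum_congr rfl fun k _ => by ring
    rw [this]
    simp only [one_apply, Fin.succ_inj]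
    ring

theorem trace_bordered_mul_bordered (t t' : ℝ) (s s' : Fin n → ℝ)
    (D D' : Matrix (Fin n) (Fin n) ℝ) :
    (bordered t s D * bordered t' s' D').trace = t * t' + 2 * (s ⬝ᵥ s') + (D * D').trace := by
  simp only [trace, diag_apply, mul_apply, Fin.sum_univ_succ, bordered_zero_zero,
    bordered_zero_succ, bordered_succ_zero, bordered_succ_succ, Finset.sum_add_distrib, dotProduct]
  ring

/-- Completing the square in the trace form `tr(S⁻¹ Ψ)`, with `S` and `Ψ` both in Schur complement
coordinates. -/
theorem trace_inv_bordered_mul {u : ℝ} (hu : u ≠ 0) (w : Fin n → ℝ)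
    {D : Matrix (Fin n) (Fin n) ℝ} (hD : D.PosDef) (c : ℝ) (v : Fin n → ℝ)
    {F : Matrix (Fin n) (Fin n) ℝ} (hF : F.PosDef) :
    ((bordered (u + w ⬝ᵥ (D *ᵥ w)) (D *ᵥ w) D)⁻¹ *
        bordered (c + v ⬝ᵥ (F *ᵥ v)) (F *ᵥ v) F).trace =
      u⁻¹ * (c + (w - v) ⬝ᵥ (F *ᵥ (w - v))) + (D⁻¹ * F).trace := by
  have hT : Fᵀ = F := by simpa [IsHermitian] using hF.1
  have h1 : v ⬝ᵥ (F *ᵥ w) = w ⬝ᵥ (F *ᵥ v) := by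
    rw [dotProduct_mulVec, ← mulVec_transpose, hT, dotProduct_comm]
  have h2 : (vecMulVec w w * F).trace = w ⬝ᵥ (F *ᵥ w) := by
    rw [vecMulVec_mul, trace_vecMulVec, dotProduct_mulVec, dotProduct_comm]
  rw [inv_bordered hu w hD, trace_bordered_mul_bordered, add_mul, trace_add, smul_mul_assoc,
    trace_smul, h2]
  simp only [mulVec_sub, dotProduct_sub, sub_dotProduct, smul_dotProduct, smul_eq_mul, h1]
  ring

/-! ### Lebesgue measure on symmetric matrices in Schur complement coordinates -/

/-- The positions on and above the diagonal, sorted into the first row and the others. -/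
def upperSuccEquiv (n : ℕ) : Fin (n + 1) ⊕ {p : Fin n × Fin n // p.1 ≤ p.2} ≃
    {p : Fin (n + 1) × Fin (n + 1) // p.1 ≤ p.2} :=
  Equiv.ofBijective
    (Sum.elim (fun j => ⟨(0, j), Fin.zero_le _⟩)
      (fun p => ⟨(p.1.1.succ, p.1.2.succ), Fin.succ_le_succ_iff.2 p.2⟩)) <| by
    constructor
    · rintro (i | ⟨⟨i, i'⟩, hi⟩) (j | ⟨⟨j, j'⟩, hj⟩) h
      · simpa using h
      · simp [Fin.ext_iff] at h
      · simp [Fin.ext_iff] at h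
      · simpa using h
    · rintro ⟨⟨i, j⟩, h⟩
      refine Fin.cases (fun h => ⟨Sum.inl j, rfl⟩) (fun i => ?_) i h
      refine Fin.cases (fun h => absurd h (by simp)) (fun j h => ?_) j
      exact ⟨Sum.inr ⟨(i, j), Fin.succ_le_succ_iff.1 h⟩, rfl⟩

theorem measurable_symOfUpper : Measurable (symOfUpper (n := n)) :=
  measurable_matrix_of_entries fun _ _ => measurable_pi_apply _

theorem symOfUpper_upperSuccEquiv (x : Fin (n + 1) → ℝ)
    (y : {p : Fin n × Fin n // p.1 ≤ p.2} → ℝ) :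
    symOfUpper (fun a => Sum.elim x y ((upperSuccEquiv n).symm a)) =
      bordered (x 0) (fun i => x i.succ) (symOfUpper y) := by
  have h1 : ∀ j h, (upperSuccEquiv n).symm ⟨(0, j), h⟩ = Sum.inl j := fun j h =>
    (Equiv.symm_apply_eq _).2 rfl
  have h2 : ∀ i j h, (upperSuccEquiv n).symm ⟨(i.succ, j.succ), h⟩ =
      Sum.inr ⟨(i, j), Fin.succ_le_succ_iff.1 h⟩ := fun i j h =>
    (Equiv.symm_apply_eq _).2 rfl
  ext i j
  refine Fin.cases ?_ (fun i => ?_) i <;> refine Fin.cases ?_ (fun j => ?_) j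
  · simp [symOfUpper, h1]
  · simp [symOfUpper, h1]
  · simp [symOfUpper, h1]
  · have hmin : min i.succ j.succ = (min i j).succ := (Fin.strictMono_succ.monotone.map_min).symm
    have hmax : max i.succ j.succ = (max i j).succ := (Fin.strictMono_succ.monotone.map_max).symm
    simp [symOfUpper, hmin, hmax, h2]

/-- Lebesgue measure on symmetric matrices splits into the lower right block `D`, the rest `s` of
the first row, and the corner `t`. -/
theorem lintegral_symLebesgue_succ {f : Matrix (Fin (n + 1)) (Fin (n + 1)) ℝ → ENNReal}
    (hf : Measurable f) :
    ∫⁻ S, f S ∂symLebesgue (n + 1) =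
      ∫⁻ D, (∫⁻ s : Fin n → ℝ, ∫⁻ t : ℝ, f (bordered t s D)) ∂symLebesgue n := by
  have hfb : Measurable fun x : Matrix (Fin n) (Fin n) ℝ × (Fin n → ℝ) × ℝ =>
      f (bordered x.2.2 x.2.1 x.1) := hf.comp measurable_bordered
  have hin : Measurable fun D : Matrix (Fin n) (Fin n) ℝ =>
      ∫⁻ s : Fin n → ℝ, ∫⁻ t : ℝ, f (bordered t s D) := by
    refine Measurable.lintegral_prod_right (f := fun D s => ∫⁻ t : ℝ, f (bordered t s D)) ?_
    refine Measurable.lintegral_prod_right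
      (f := fun (p : Matrix (Fin n) (Fin n) ℝ × (Fin n → ℝ)) t => f (bordered t p.2 p.1)) ?_
    exact hfb.comp (f := fun q : (Matrix (Fin n) (Fin n) ℝ × (Fin n → ℝ)) × ℝ =>
      (q.1.1, q.1.2, q.2)) (by fun_prop)
  have hmp := (volume_measurePreserving_piCongrLeft (fun _ => ℝ) (upperSuccEquiv n)).comp
    (volume_measurePreserving_sumPiEquivProdPi_symm
      (fun _ : Fin (n + 1) ⊕ {p : Fin n × Fin n // p.1 ≤ p.2} => ℝ))
  have hfs := hf.comp (measurable_symOfUpper (n := n + 1))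
  have hval : ∀ z : (Fin (n + 1) → ℝ) × ({p : Fin n × Fin n // p.1 ≤ p.2} → ℝ),
      symOfUpper ((MeasurableEquiv.piCongrLeft (fun _ => ℝ) (upperSuccEquiv n) ∘
        (MeasurableEquiv.sumPiEquivProdPi
          (fun _ : Fin (n + 1) ⊕ {p : Fin n × Fin n // p.1 ≤ p.2} => ℝ)).symm) z) =
      bordered (z.1 0) (fun i => z.1 i.succ) (symOfUpper z.2) := by
    rintro ⟨x, y⟩
    rw [← symOfUpper_upperSuccEquiv]
    congr 1
    ext a
    obtain ⟨b, rfl⟩ := (upperSuccEquiv n).surjective a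
    simp only [Function.comp_apply, MeasurableEquiv.coe_piCongrLeft, Equiv.symm_apply_apply]
    rw [Equiv.piCongrLeft_apply_apply]
    rcases b with b | b <;> rfl
  rw [symLebesgue, symLebesgue, lintegral_map hf measurable_symOfUpper,
    lintegral_map hin measurable_symOfUpper]
  have e1 := hmp.lintegral_comp hfs
  simp only [Function.comp_apply] at e1
  rw [← e1]
  have hval' : ∀ z : (Fin (n + 1) → ℝ) × ({p : Fin n × Fin n // p.1 ≤ p.2} → ℝ), _ :=
    fun z => congrArg f (hval z)
  simp only [Function.comp_apply] at hval'
  rw [lintegral_congr hval']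
  rw [show (volume : Measure ((Fin (n + 1) → ℝ) × ({p : Fin n × Fin n // p.1 ≤ p.2} → ℝ))) =
    volume.prod volume from rfl]
  have hx : Measurable fun z : (Fin (n + 1) → ℝ) × ({p : Fin n × Fin n // p.1 ≤ p.2} → ℝ) =>
      f (bordered (z.1 0) (fun i => z.1 i.succ) (symOfUpper z.2)) :=
    hfb.comp (g := fun x : Matrix (Fin n) (Fin n) ℝ × (Fin n → ℝ) × ℝ =>
      f (bordered x.2.2 x.2.1 x.1)) (f := fun z : (Fin (n + 1) → ℝ) × _ =>
        (symOfUpper z.2, (fun i => z.1 i.succ), z.1 0))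
      ((measurable_symOfUpper.comp measurable_snd).prodMk (by fun_prop))
  rw [lintegral_prod_symm _ hx.aemeasurable]
  refine lintegral_congr fun y => ?_
  have hmp2 := (volume_preserving_piFinSuccAbove (fun _ : Fin (n + 1) => ℝ) 0).symm
  have hxy : Measurable fun x : Fin (n + 1) → ℝ =>
    f (bordered (x 0) (fun i => x i.succ) (symOfUpper y)) :=
    hx.comp (f := fun x : Fin (n + 1) → ℝ => (x, y)) (by fun_prop)
  have e2 := hmp2.lintegral_comp hxy
  rw [← e2]
  rw [show (volume : Measure (ℝ × (Fin n → ℝ))) = volume.prod volume from rfl]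
  have h3 : ∀ z : ℝ × (Fin n → ℝ), f (bordered
      ((MeasurableEquiv.piFinSuccAbove (fun _ : Fin (n + 1) => ℝ) 0).symm z 0)
      (fun i => (MeasurableEquiv.piFinSuccAbove (fun _ : Fin (n + 1) => ℝ) 0).symm z i.succ)
      (symOfUpper y)) = f (bordered z.1 z.2 (symOfUpper y)) := by
    intro z
    rfl
  simp only [h3]
  rw [lintegral_prod_symm]
  exact (hfb.comp (g := fun x : Matrix (Fin n) (Fin n) ℝ × (Fin n → ℝ) × ℝ =>
      f (bordered x.2.2 x.2.1 x.1)) (f := fun z : ℝ × (Fin n → ℝ) =>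
        (symOfUpper y, z.2, z.1)) (by fun_prop)).aemeasurable

/-- The substitution `s = D w`, `t = u + wᵀ D w`. -/
theorem lintegral_bordered {D : Matrix (Fin n) (Fin n) ℝ} (hD : D.PosDef)
    {f : Matrix (Fin (n + 1)) (Fin (n + 1)) ℝ → ENNReal} (hf : Measurable f) :
    ∫⁻ s : Fin n → ℝ, ∫⁻ t : ℝ, f (bordered t s D) =
      ENNReal.ofReal D.det *
        ∫⁻ u : ℝ, ∫⁻ w : Fin n → ℝ, f (bordered (u + w ⬝ᵥ (D *ᵥ w)) (D *ᵥ w) D) := by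
  have hdet := hD.det_pos
  have hfb : Measurable fun x : Matrix (Fin n) (Fin n) ℝ × (Fin n → ℝ) × ℝ =>
      f (bordered x.2.2 x.2.1 x.1) := hf.comp measurable_bordered
  have hm1 : Measurable fun p : (Fin n → ℝ) × ℝ => f (bordered p.2 p.1 D) :=
    hfb.comp (g := fun x : Matrix (Fin n) (Fin n) ℝ × (Fin n → ℝ) × ℝ =>
      f (bordered x.2.2 x.2.1 x.1)) (f := fun p : (Fin n → ℝ) × ℝ => (D, p.1, p.2)) (by fun_prop)
  have hm : Measurable fun s : Fin n → ℝ => ∫⁻ t : ℝ, f (bordered t s D) :=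
    Measurable.lintegral_prod_right (f := fun s t => f (bordered t s D)) hm1
  have hm2 : Measurable fun p : ℝ × (Fin n → ℝ) =>
      f (bordered (p.1 + p.2 ⬝ᵥ (D *ᵥ p.2)) (D *ᵥ p.2) D) :=
    hm1.comp (g := fun p : (Fin n → ℝ) × ℝ => f (bordered p.2 p.1 D))
      (f := fun p : ℝ × (Fin n → ℝ) => (D *ᵥ p.2, p.1 + p.2 ⬝ᵥ (D *ᵥ p.2)))
      (Continuous.measurable (by fun_prop))
  have h := lintegral_comp_mulVec hdet.ne' hm
  rw [lintegral_lintegral_swap (f := fun (u : ℝ) (w : Fin n → ℝ) =>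
    f (bordered (u + w ⬝ᵥ (D *ᵥ w)) (D *ᵥ w) D)) hm2.aemeasurable]
  have h2 : ∀ w : Fin n → ℝ, ∫⁻ u : ℝ, f (bordered (u + w ⬝ᵥ (D *ᵥ w)) (D *ᵥ w) D) =
      ∫⁻ t : ℝ, f (bordered t (D *ᵥ w) D) := fun w =>
    lintegral_add_right_eq_self (fun t => f (bordered t (D *ᵥ w) D)) _
  rw [lintegral_congr h2, h, ← mul_assoc, ← ENNReal.ofReal_mul hdet.le,
    abs_of_pos (inv_pos.2 hdet), mul_inv_cancel₀ hdet.ne', ENNReal.ofReal_one, one_mul]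

/-! ### The normalizing constant of the inverse Wishart distribution -/

/-- The inverse gamma integral, from the gamma integral by `u ↦ u⁻¹`. -/
theorem lintegral_inverseGamma {a c : ℝ} (ha : 0 < a) (hc : 0 < c) :
    ∫⁻ u in Set.Ioi (0 : ℝ), ENNReal.ofReal (u ^ (-(a + 1)) * Real.exp (-(c / u))) =
      ENNReal.ofReal (c ^ (-a) * Real.Gamma a) := by
  let g : ℝ → ℝ := fun y => y ^ (a - 1) * Real.exp (-(c * y))
  have hI : ∫ y in Set.Ioi (0 : ℝ), g y = c ^ (-a) * Real.Gamma a := by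
    rw [Real.integral_rpow_mul_exp_neg_mul_Ioi ha hc, one_div, Real.inv_rpow hc.le,
      Real.rpow_neg hc.le]
  have hg : IntegrableOn g (Set.Ioi 0) := by
    by_contra h
    rw [integral_undef h] at hI
    have := Real.Gamma_pos_of_pos ha
    have := Real.rpow_pos_of_pos hc (-a)
    exact absurd hI (by positivity)
  have heq : ∀ u ∈ Set.Ioi (0 : ℝ), (|(-1 : ℝ)| * u ^ ((-1 : ℝ) - 1)) • g (u ^ (-1 : ℝ)) =
      u ^ (-(a + 1)) * Real.exp (-(c / u)) := by
    intro u hu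
    have hu : (0 : ℝ) < u := hu
    simp only [g, smul_eq_mul, abs_neg, abs_one, one_mul]
    rw [← Real.rpow_mul hu.le, ← mul_assoc, ← Real.rpow_add hu, Real.rpow_neg_one, ← div_eq_mul_inv]
    ring_nf
  have hg' := ((integrableOn_Ioi_comp_rpow_iff g (p := -1) (by norm_num)).2 hg).congr_fun heq
    measurableSet_Ioi
  rw [← ofReal_integral_eq_lintegral_ofReal hg', ← hI,
    ← integral_comp_rpow_Ioi g (p := -1) (by norm_num), setIntegral_congr_fun measurableSet_Ioi heq]
  filter_upwards [ae_restrict_mem measurableSet_Ioi] with u hu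
  have hu : (0 : ℝ) < u := hu
  simp only [Pi.zero_apply]
  positivity

open scoped Classical in
/-- The unnormalized inverse Wishart density. -/
def inverseWishartKernel {p : ℕ} (Ψ : Matrix (Fin p) (Fin p) ℝ) (ν : ℝ)
    (S : Matrix (Fin p) (Fin p) ℝ) : ℝ :=
  if S.PosDef then S.det ^ (-((p : ℝ) + ν + 1) / 2) * Real.exp (-(1 / 2) * (S⁻¹ * Ψ).trace) else 0

theorem measurable_trace_inv_mul (Ψ : Matrix (Fin n) (Fin n) ℝ) :
    Measurable fun S : Matrix (Fin n) (Fin n) ℝ => (S⁻¹ * Ψ).trace :=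
  (Continuous.measurable (f := fun S : Matrix (Fin n) (Fin n) ℝ => (S * Ψ).trace)
    (by fun_prop)).comp measurable_matrix_inv

theorem measurable_inverseWishartKernel (Ψ : Matrix (Fin n) (Fin n) ℝ) (ν : ℝ) :
    Measurable (inverseWishartKernel Ψ ν) := by
  have := measurable_trace_inv_mul Ψ
  exact Measurable.ite measurableSet_posDef
    ((measurable_matrix_det.pow_const _).mul (by fun_prop)) measurable_const

/-- The contribution of the first row of `S`, given the remaining block `D`, to the inverse Wishart
integral: a Gaussian integral in `w` and then an inverse gamma integral in `u`. -/
theorem lintegral_inverseWishartKernel_bordered {ν c : ℝ} (hν : 0 < ν) (hc : 0 < c)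
    (v : Fin n → ℝ) {F D : Matrix (Fin n) (Fin n) ℝ} (hF : F.PosDef) (hD : D.PosDef) :
    ENNReal.ofReal D.det * ∫⁻ u : ℝ, ∫⁻ w : Fin n → ℝ, ENNReal.ofReal
        (inverseWishartKernel (bordered (c + v ⬝ᵥ (F *ᵥ v)) (F *ᵥ v) F) ν
          (bordered (u + w ⬝ᵥ (D *ᵥ w)) (D *ᵥ w) D)) =
      ENNReal.ofReal (inverseWishartKernel F (ν - 1) D) *
        ENNReal.ofReal ((2 * Real.pi) ^ ((n : ℝ) / 2) * F.det ^ (-(1 / 2) : ℝ) *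
          ((c / 2) ^ (-(ν / 2)) * Real.Gamma (ν / 2))) := by
  have hDdet := hD.det_pos
  have hFdet := hF.det_pos
  set e : ℝ := -(((n + 1 : ℕ) : ℝ) + ν + 1) / 2 with he
  set C : ℝ := D.det ^ e * Real.exp (-(1 / 2) * (D⁻¹ * F).trace) with hC
  have hC0 : 0 < C := by positivity
  have hgauss : ∀ u : ℝ, 0 < u → ∫⁻ w : Fin n → ℝ,
      ENNReal.ofReal (Real.exp (-(1 / 2) * (u⁻¹ * (w ⬝ᵥ (F *ᵥ w))))) =
      ENNReal.ofReal ((2 * Real.pi) ^ ((n : ℝ) / 2) * F.det ^ (-(1 / 2) : ℝ) *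
        u ^ ((n : ℝ) / 2)) := by
    intro u hu
    have h := lintegral_exp_neg_quadForm (hF.inv.smul hu)
    have hinv : (u • F⁻¹)⁻¹ = u⁻¹ • F := by
      have := invertibleOfNonzero hu.ne'
      rw [inv_smul _ _ hF.inv.det_pos.ne'.isUnit, nonsing_inv_nonsing_inv _ hFdet.ne'.isUnit,
        invOf_eq_inv]
    rw [hinv, det_smul, det_nonsing_inv, Ring.inverse_eq_inv', Fintype.card_fin] at h
    simp only [smul_mulVec, dotProduct_smul, smul_eq_mul] at h
    rw [h]
    congr 1
    rw [Real.mul_rpow (pow_pos hu n).le (inv_pos.2 hFdet).le, ← Real.rpow_natCast,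
      ← Real.rpow_mul hu.le, Real.inv_rpow hFdet.le, Real.rpow_neg hFdet.le]
    ring_nf
  have hin : ∀ u : ℝ, ∫⁻ w : Fin n → ℝ, ENNReal.ofReal
      (inverseWishartKernel (bordered (c + v ⬝ᵥ (F *ᵥ v)) (F *ᵥ v) F) ν
        (bordered (u + w ⬝ᵥ (D *ᵥ w)) (D *ᵥ w) D)) =
      (Set.Ioi (0 : ℝ)).indicator (fun u => ENNReal.ofReal
        (C * ((2 * Real.pi) ^ ((n : ℝ) / 2) * F.det ^ (-(1 / 2) : ℝ))) *
        ENNReal.ofReal (u ^ (-(ν / 2 + 1)) * Real.exp (-(c / 2 / u)))) u := by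
    intro u
    by_cases hu : 0 < u
    · have h1 : ∀ w : Fin n → ℝ, ENNReal.ofReal
          (inverseWishartKernel (bordered (c + v ⬝ᵥ (F *ᵥ v)) (F *ᵥ v) F) ν
            (bordered (u + w ⬝ᵥ (D *ᵥ w)) (D *ᵥ w) D)) =
          ENNReal.ofReal (C * u ^ e * Real.exp (-(c / 2 / u))) * ENNReal.ofReal
            (Real.exp (-(1 / 2) * (u⁻¹ * ((w - v) ⬝ᵥ (F *ᵥ (w - v)))))) := by
        intro w
        rw [inverseWishartKernel, if_pos ((posDef_bordered_iff u w hD).2 hu), det_bordered u w hD,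
          trace_inv_bordered_mul hu.ne' w hD c v hF, ← ENNReal.ofReal_mul (by positivity),
          Real.mul_rpow hu.le hDdet.le, ← he, hC]
        congr 1
        have h2 : -(1 / 2) * (u⁻¹ * (c + (w - v) ⬝ᵥ (F *ᵥ (w - v))) + (D⁻¹ * F).trace) =
            -(1 / 2) * (D⁻¹ * F).trace + -(c / 2 / u) +
              -(1 / 2) * (u⁻¹ * ((w - v) ⬝ᵥ (F *ᵥ (w - v)))) := by
          field_simp
          ring
        rw [h2, Real.exp_add, Real.exp_add]
        ring
      rw [lintegral_congr h1, lintegral_const_mul _ (by fun_prop),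
        lintegral_sub_right_eq_self (fun w => ENNReal.ofReal
          (Real.exp (-(1 / 2) * (u⁻¹ * (w ⬝ᵥ (F *ᵥ w)))))) v, hgauss u hu,
        Set.indicator_of_mem (Set.mem_Ioi.2 hu), ← ENNReal.ofReal_mul (by positivity),
        ← ENNReal.ofReal_mul (by positivity)]
      congr 1
      have h3 : u ^ (-(ν / 2 + 1)) = u ^ e * u ^ ((n : ℝ) / 2) := by
        rw [← Real.rpow_add hu, he]
        congr 1
        push_cast
        ring
      rw [h3]
      ring
    · rw [Set.indicator_of_notMem (by simpa using hu)]
      simp [inverseWishartKernel, posDef_bordered_iff _ _ hD, hu]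
  rw [lintegral_congr hin, lintegral_indicator measurableSet_Ioi,
    lintegral_const_mul _ (by fun_prop), lintegral_inverseGamma (by positivity) (by positivity), inverseWishartKernel, if_pos hD,
    ← ENNReal.ofReal_mul (by positivity), ← ENNReal.ofReal_mul (by positivity),
    ← ENNReal.ofReal_mul (by positivity)]
  congr 1
  have h4 : D.det ^ (-((n : ℝ) + (ν - 1) + 1) / 2) = D.det * D.det ^ e := by
    rw [mul_comm, ← Real.rpow_add_one hDdet.ne', he]
    congr 1
    push_cast
    ring
  rw [h4, hC]
  ring

theorem multivariateGamma_pos {p : ℕ} {a : ℝ} (ha : ((p : ℝ) - 1) / 2 < a) :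
    0 < multivariateGamma p a := by
  refine mul_pos (by positivity) (Finset.prod_pos fun j hj => Real.Gamma_pos_of_pos ?_)
  have : (j : ℝ) ≤ p := by exact_mod_cast (Finset.mem_Icc.1 hj).2
  linarith

/-- Shifting the argument by `1 / 2` shifts the factors of `Γ_p` by one index, so that the products
defining `Γ_p(a + 1 / 2)` and `Γ_p(a)` agree up to their first and last factors. -/
theorem multivariateGamma_add_half (p : ℕ) (a : ℝ) :
    multivariateGamma p (a + 1 / 2) * Real.Gamma (a + (1 - (p : ℝ)) / 2) =
      multivariateGamma p a * Real.Gamma (a + 1 / 2) := by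
  have h : ∀ p : ℕ, (∏ j ∈ Finset.Icc 1 p, Real.Gamma (a + 1 / 2 + (1 - (j : ℝ)) / 2)) *
      Real.Gamma (a + (1 - (p : ℝ)) / 2) =
      (∏ j ∈ Finset.Icc 1 p, Real.Gamma (a + (1 - (j : ℝ)) / 2)) * Real.Gamma (a + 1 / 2) := by
    intro p
    induction p with
    | zero => simp
    | succ p ih =>
      rw [Finset.prod_Icc_succ_top (by omega), Finset.prod_Icc_succ_top (by omega)]
      have : a + 1 / 2 + (1 - ((p + 1 : ℕ) : ℝ)) / 2 = a + (1 - (p : ℝ)) / 2 := by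
        push_cast
        ring
      rw [this, ih]
      ring
  rw [multivariateGamma, multivariateGamma, mul_assoc, h p]
  ring

theorem multivariateGamma_succ (p : ℕ) (a : ℝ) :
    multivariateGamma (p + 1) a =
      Real.pi ^ ((p : ℝ) / 2) * Real.Gamma a * multivariateGamma p (a - 1 / 2) := by
  have h1 : Real.pi ^ (((p + 1 : ℕ) : ℝ) * (((p + 1 : ℕ) : ℝ) - 1) / 4) =
      Real.pi ^ ((p : ℝ) / 2) * Real.pi ^ ((p : ℝ) * ((p : ℝ) - 1) / 4) := by
    rw [← Real.rpow_add Real.pi_pos]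
    push_cast
    ring_nf
  have h2 := multivariateGamma_add_half p (a - 1 / 2)
  have h3 : a - 1 / 2 + (1 - (p : ℝ)) / 2 = a + (1 - ((p + 1 : ℕ) : ℝ)) / 2 := by
    push_cast
    ring
  rw [sub_add_cancel, h3] at h2
  rw [mul_assoc, mul_comm (Real.Gamma a), ← h2, multivariateGamma, multivariateGamma, h1,
    Finset.prod_Icc_succ_top (by omega)]
  ring

/-- The normalization of the inverse Wishart distribution, by induction on the dimension: splitting
off the first row leaves the same integral in dimension one less with `ν - 1` degrees of freedom. -/
theorem lintegral_inverseWishartKernel {p : ℕ} {Ψ : Matrix (Fin p) (Fin p) ℝ} {ν : ℝ}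
    (hΨ : Ψ.PosDef) (hν : (p : ℝ) - 1 < ν) :
    ∫⁻ S, ENNReal.ofReal (inverseWishartKernel Ψ ν S) ∂symLebesgue p =
      ENNReal.ofReal (2 ^ (ν * (p : ℝ) / 2) * multivariateGamma p (ν / 2) *
        Ψ.det ^ (-(ν / 2))) := by
  induction p generalizing ν with
  | zero =>
    have h : ∀ S : Matrix (Fin 0) (Fin 0) ℝ, inverseWishartKernel Ψ ν S = 1 := by
      intro S
      have : S = 1 := Subsingleton.elim _ _
      subst this
      rw [inverseWishartKernel, if_pos PosDef.one]
      simp [trace]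
    have hu : symLebesgue 0 Set.univ = 1 := by
      rw [symLebesgue, Measure.map_apply measurable_symOfUpper .univ, Set.preimage_univ]
      have : IsEmpty {p : Fin 0 × Fin 0 // p.1 ≤ p.2} := ⟨fun p => p.1.1.elim0⟩
      rw [← Set.pi_univ Set.univ, volume_pi_pi]
      simp
    simp [h, hu, multivariateGamma]
  | succ n ih =>
    push_cast at hν
    have hn : (0 : ℝ) ≤ n := n.cast_nonneg
    have hν0 : 0 < ν := by linarith
    obtain ⟨c, v, F, hF, rfl⟩ := exists_eq_bordered hΨ
    have hc := (posDef_bordered_iff c v hF).1 hΨ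
    have hFdet := hF.det_pos
    have hmeas := (measurable_inverseWishartKernel
      (bordered (c + v ⬝ᵥ (F *ᵥ v)) (F *ᵥ v) F) ν).ennreal_ofReal
    set K := (2 * Real.pi) ^ ((n : ℝ) / 2) * F.det ^ (-(1 / 2) : ℝ) *
      ((c / 2) ^ (-(ν / 2)) * Real.Gamma (ν / 2)) with hK
    have hin : ∀ D : Matrix (Fin n) (Fin n) ℝ, ∫⁻ s : Fin n → ℝ, ∫⁻ t : ℝ, ENNReal.ofReal
        (inverseWishartKernel (bordered (c + v ⬝ᵥ (F *ᵥ v)) (F *ᵥ v) F) ν (bordered t s D)) =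
        ENNReal.ofReal (inverseWishartKernel F (ν - 1) D) * ENNReal.ofReal K := by
      intro D
      by_cases hD : D.PosDef
      · rw [lintegral_bordered hD hmeas,
          lintegral_inverseWishartKernel_bordered hν0 hc v hF hD]
      · have h : ∀ t s, ¬ (bordered t s D).PosDef := fun t s h => hD (posDef_of_posDef_bordered h)
        simp [inverseWishartKernel, h, hD]
    rw [lintegral_symLebesgue_succ hmeas, lintegral_congr hin, lintegral_mul_const _
      (measurable_inverseWishartKernel _ _).ennreal_ofReal, ih hF (by linarith)]
    have hG : 0 < multivariateGamma n ((ν - 1) / 2) := multivariateGamma_pos (by linarith)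
    rw [← ENNReal.ofReal_mul (by positivity)]
    congr 1
    rw [det_bordered c v hF, multivariateGamma_succ, hK, Real.mul_rpow hc.le hFdet.le,
      Real.mul_rpow two_pos.le Real.pi_pos.le, Real.div_rpow hc.le two_pos.le]
    have e1 : (ν - 1) / 2 = ν / 2 - 1 / 2 := by ring
    have e2 : (2 : ℝ) ^ (ν * ((n + 1 : ℕ) : ℝ) / 2) =
        2 ^ ((ν - 1) * (n : ℝ) / 2) * 2 ^ ((n : ℝ) / 2) * 2 ^ (ν / 2) := by
      rw [← Real.rpow_add two_pos, ← Real.rpow_add two_pos]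
      push_cast
      ring_nf
    have e3 : F.det ^ (-(ν / 2)) = F.det ^ (-((ν - 1) / 2)) * F.det ^ (-(1 / 2) : ℝ) := by
      rw [← Real.rpow_add hFdet]
      ring_nf
    have e4 : (2 : ℝ) ^ (-(ν / 2)) = (2 ^ (ν / 2))⁻¹ := Real.rpow_neg two_pos.le _
    rw [e2, e3, e4, ← e1]
    field_simp

/-! ### Integrating out the regression matrix -/

/-- Stacking the entries of a matrix into one vector preserves Lebesgue measure. -/
theorem map_vec_matrixLebesgue (m n : ℕ) :
    (matrixLebesgue m n).map vec = (volume : Measure (Fin n × Fin m → ℝ)) := by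
  have hof : Measurable (Matrix.of : (Fin m → Fin n → ℝ) ≃ Matrix (Fin m) (Fin n) ℝ) :=
    measurable_matrix_of_entries fun i j => by
      simp only [of_apply]
      fun_prop
  have hvec : Measurable (vec : Matrix (Fin m) (Fin n) ℝ → Fin n × Fin m → ℝ) :=
    Continuous.measurable (by unfold vec; fun_prop)
  rw [matrixLebesgue, Measure.map_map hvec hof]
  refine (Measure.pi_eq fun s hs => ?_).symm
  rw [Measure.map_apply (hvec.comp hof) (.univ_pi hs)]
  have : (vec ∘ Matrix.of) ⁻¹' Set.univ.pi s =
      Set.univ.pi fun i : Fin m => Set.univ.pi fun j : Fin n => s (j, i) := by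
    ext g
    simp only [Set.mem_preimage, Set.mem_pi, Set.mem_univ, true_imp_iff, Prod.forall]
    exact ⟨fun h i j => h j i, fun h j i => h i j⟩
  rw [this, volume_pi_pi]
  simp_rw [volume_pi_pi]
  rw [Fintype.prod_prod_type_right]

theorem lintegral_vec {m n : ℕ} {f : (Fin n × Fin m → ℝ) → ENNReal} (hf : Measurable f) :
    ∫⁻ B, f (vec B) ∂matrixLebesgue m n = ∫⁻ z, f z := by
  have hvec : Measurable (vec : Matrix (Fin m) (Fin n) ℝ → Fin n × Fin m → ℝ) :=
    Continuous.measurable (by unfold vec; fun_prop)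
  rw [← map_vec_matrixLebesgue, lintegral_map hf hvec]

variable {p q : ℕ}

/-- The matrix normal integral. The quadratic form `tr(Bᵀ S⁻¹ B V⁻¹)` has the matrix
`(V ⊗ S)⁻¹` in the entries of `B`. -/
theorem lintegral_exp_neg_trace {S : Matrix (Fin p) (Fin p) ℝ} {V : Matrix (Fin q) (Fin q) ℝ}
    (hS : S.PosDef) (hV : V.PosDef) (M : Matrix (Fin p) (Fin q) ℝ) :
    ∫⁻ A, ENNReal.ofReal (Real.exp (-(1 / 2) * ((A - M)ᵀ * S⁻¹ * (A - M) * V⁻¹).trace))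
        ∂matrixLebesgue p q =
      ENNReal.ofReal ((2 * Real.pi) ^ ((p : ℝ) * (q : ℝ) / 2) * V.det ^ ((p : ℝ) / 2) *
        S.det ^ ((q : ℝ) / 2)) := by
  have hVT : (V⁻¹)ᵀ = V⁻¹ := by simpa [IsHermitian] using hV.inv.1
  have hVd := hV.det_pos
  have hSd := hS.det_pos
  have h := lintegral_exp_neg_quadForm (hV.kronecker hS)
  have hm : Measurable fun z : Fin q × Fin p → ℝ => ENNReal.ofReal
      (Real.exp (-(1 / 2) * (z ⬝ᵥ ((kroneckerMap (· * ·) V S)⁻¹ *ᵥ z)))) := by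
    have : Continuous fun z : Fin q × Fin p → ℝ =>
      z ⬝ᵥ ((kroneckerMap (· * ·) V S)⁻¹ *ᵥ z) := by fun_prop
    fun_prop
  have h1 : ∀ B : Matrix (Fin p) (Fin q) ℝ, (Bᵀ * S⁻¹ * B * V⁻¹).trace =
      vec B ⬝ᵥ ((kroneckerMap (· * ·) V S)⁻¹ *ᵥ vec B) := by
    intro B
    rw [inv_kronecker, kronecker_mulVec_vec, hVT, vec_dotProduct_vec]
    simp only [Matrix.mul_assoc]
  simp_rw [h1, vec_sub]
  rw [lintegral_vec (f := fun z => ENNReal.ofReal (Real.exp (-(1 / 2) *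
    ((z - vec M) ⬝ᵥ ((kroneckerMap (· * ·) V S)⁻¹ *ᵥ (z - vec M))))))
    (hm.comp (measurable_id.sub_const _)),
    lintegral_sub_right_eq_self (fun z => ENNReal.ofReal (Real.exp (-(1 / 2) *
    (z ⬝ᵥ ((kroneckerMap (· * ·) V S)⁻¹ *ᵥ z))))), h, det_kronecker]
  congr 1
  rw [Real.mul_rpow (pow_pos hVd _).le (pow_pos hSd _).le, ← Real.rpow_natCast,
    ← Real.rpow_natCast, ← Real.rpow_mul hVd.le, ← Real.rpow_mul hSd.le]
  simp only [Fintype.card_prod, Fintype.card_fin, Nat.cast_mul]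
  ring_nf

theorem det_add_vecMulVec {A : Matrix (Fin p) (Fin p) ℝ} (hA : IsUnit A.det) (u v : Fin p → ℝ) :
    (A + vecMulVec u v).det = A.det * (1 + v ⬝ᵥ (A⁻¹ *ᵥ u)) := by
  rw [vecMulVec_eq Unit, det_add_replicateCol_mul_replicateRow hA, det_unique (n := Unit),
    Matrix.mul_assoc, ← replicateCol_mulVec]
  simp [Matrix.add_apply, mul_apply, dotProduct]

theorem posSemidef_vecMulVec_self (b : Fin p → ℝ) : (vecMulVec b b).PosSemidef := by
  simpa using posSemidef_vecMulVec_self_star b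

/-- Completing the square in `B` in the exponent of the joint density of `ξ` and the regression
matrix. -/
theorem quadForm_add_trace {G : Matrix (Fin p) (Fin p) ℝ} (hG : Gᵀ = G)
    {V : Matrix (Fin q) (Fin q) ℝ} (hV : V.PosDef) (b : Fin q → ℝ) (r : Fin p → ℝ) {c : ℝ}
    (hc : c = 1 + b ⬝ᵥ (V *ᵥ b)) (hc0 : c ≠ 0) (B : Matrix (Fin p) (Fin q) ℝ) :
    (r - B *ᵥ b) ⬝ᵥ (G *ᵥ (r - B *ᵥ b)) + (Bᵀ * G * B * V⁻¹).trace =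
      ((B - c⁻¹ • vecMulVec r (V *ᵥ b))ᵀ * G * (B - c⁻¹ • vecMulVec r (V *ᵥ b)) *
        (V⁻¹ + vecMulVec b b)).trace + c⁻¹ * (r ⬝ᵥ (G *ᵥ r)) := by
  have hVT : Vᵀ = V := by simpa [IsHermitian] using hV.1
  have hVu := hV.det_pos.ne'.isUnit
  have hG2 : ∀ x y : Fin p → ℝ, x ⬝ᵥ (G *ᵥ y) = y ⬝ᵥ (G *ᵥ x) := fun x y => by
    rw [dotProduct_mulVec, ← mulVec_transpose, hG, dotProduct_comm]
  have hVb : (V *ᵥ b) ᵥ* V⁻¹ = b := by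
    rw [← vecMul_transpose, hVT, vecMul_vecMul, mul_nonsing_inv _ hVu, vecMul_one]
  have hVb' : V⁻¹ *ᵥ (V *ᵥ b) = b := by
    rw [mulVec_mulVec, nonsing_inv_mul _ hVu, one_mulVec]
  set C := B - c⁻¹ • vecMulVec r (V *ᵥ b) with hC
  have hCb : C *ᵥ b = B *ᵥ b - (c⁻¹ * (c - 1)) • r := by
    rw [hC, sub_mulVec, smul_mulVec, vecMulVec_mulVec, hc]
    ext i
    simp [dotProduct_comm (V *ᵥ b) b]
    ring
  have h1 : (Cᵀ * G * C * vecMulVec b b).trace = (C *ᵥ b) ⬝ᵥ (G *ᵥ (C *ᵥ b)) := by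
    rw [mul_vecMulVec, trace_vecMulVec, ← mulVec_mulVec, ← mulVec_mulVec, dotProduct_comm,
      dotProduct_mulVec, vecMul_transpose]
  have h2 : ∀ X : Matrix (Fin p) (Fin q) ℝ,
      (Xᵀ * G * vecMulVec r (V *ᵥ b) * V⁻¹).trace = (X *ᵥ b) ⬝ᵥ (G *ᵥ r) := by
    intro X
    rw [mul_vecMulVec, vecMulVec_mul, hVb, trace_vecMulVec, ← mulVec_mulVec, dotProduct_comm,
      dotProduct_mulVec, vecMul_transpose]
  have h3 : ∀ X : Matrix (Fin p) (Fin q) ℝ,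
      ((vecMulVec r (V *ᵥ b))ᵀ * G * X * V⁻¹).trace = (X *ᵥ b) ⬝ᵥ (G *ᵥ r) := by
    intro X
    rw [transpose_vecMulVec, vecMulVec_mul, vecMulVec_mul, vecMulVec_mul, trace_vecMulVec,
      dotProduct_comm, ← dotProduct_mulVec, hVb', ← dotProduct_mulVec, ← dotProduct_mulVec, hG2]
  have h4 : (Cᵀ * G * C * V⁻¹).trace = (Bᵀ * G * B * V⁻¹).trace -
      2 * c⁻¹ * ((B *ᵥ b) ⬝ᵥ (G *ᵥ r)) + c⁻¹ * c⁻¹ * ((c - 1) * (r ⬝ᵥ (G *ᵥ r))) := by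
    have h5 : vecMulVec r (V *ᵥ b) *ᵥ b = (c - 1) • r := by
      rw [vecMulVec_mulVec, hc]
      ext i
      simp [dotProduct_comm (V *ᵥ b) b, mul_comm]
    rw [hC]
    simp only [transpose_sub, transpose_smul, Matrix.sub_mul, Matrix.mul_sub, Matrix.smul_mul,
      Matrix.mul_smul, trace_sub, trace_smul, h2, h3, h5, smul_dotProduct, smul_eq_mul]
    ring
  rw [Matrix.mul_add, trace_add, h1, h4, hCb]
  simp only [mulVec_sub, mulVec_smul, dotProduct_sub, sub_dotProduct, smul_dotProduct,
    dotProduct_smul, smul_eq_mul, hG2 r (B *ᵥ b)]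
  field_simp
  ring

theorem lintegral_matrixNormalPDF {S : Matrix (Fin p) (Fin p) ℝ} {V : Matrix (Fin q) (Fin q) ℝ}
    (hS : S.PosDef) (hV : V.PosDef) (M : Matrix (Fin p) (Fin q) ℝ) :
    ∫⁻ A, ENNReal.ofReal (matrixNormalPDF M S V A) ∂matrixLebesgue p q = 1 := by
  have hVd := hV.det_pos
  have hSd := hS.det_pos
  have hm : Measurable fun A : Matrix (Fin p) (Fin q) ℝ => ENNReal.ofReal
      (Real.exp (-(1 / 2) * ((A - M)ᵀ * S⁻¹ * (A - M) * V⁻¹).trace)) :=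
    (Continuous.measurable (by fun_prop)).ennreal_ofReal
  simp only [matrixNormalPDF]
  rw [lintegral_congr fun A => ENNReal.ofReal_mul (by positivity), lintegral_const_mul _ hm,
    lintegral_exp_neg_trace hS hV, ← ENNReal.ofReal_mul (by positivity), one_div,
    inv_mul_cancel₀ (by positivity), ENNReal.ofReal_one]

/-- Given the covariance `S`, the vector `ξ` is normal with covariance `(1 + bᵀ V b) S`. -/
theorem lintegral_normalPDF_mul_matrixNormalPDF {S : Matrix (Fin p) (Fin p) ℝ}
    {V : Matrix (Fin q) (Fin q) ℝ} (hS : S.PosDef) (hV : V.PosDef) (M : Matrix (Fin p) (Fin q) ℝ)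
    (b : Fin q → ℝ) (ξ : EuclideanSpace ℝ (Fin p)) {c : ℝ} (hc : c = 1 + b ⬝ᵥ (V *ᵥ b)) :
    ∫⁻ A, ENNReal.ofReal (normalPDF (WithLp.toLp 2 (A *ᵥ b)) S ξ * matrixNormalPDF M S V A)
        ∂matrixLebesgue p q =
      ENNReal.ofReal (1 / ((2 * Real.pi * c) ^ ((p : ℝ) / 2) * S.det ^ (1 / 2 : ℝ)) *
        Real.exp (-(1 / 2) * (c⁻¹ * ((ξ.ofLp - M *ᵥ b) ⬝ᵥ (S⁻¹ *ᵥ (ξ.ofLp - M *ᵥ b)))))) := by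
  have hVd := hV.det_pos
  have hSd := hS.det_pos
  have hc0 : 0 < c := by
    have := (posSemidef_iff_dotProduct_mulVec.1 hV.posSemidef).2 b
    simp only [star_trivial] at this
    linarith
  have hST : (S⁻¹)ᵀ = S⁻¹ := by simpa [IsHermitian] using hS.inv.1
  set W := V⁻¹ + vecMulVec b b with hW
  have hWp : W.PosDef := hV.inv.add_posSemidef (posSemidef_vecMulVec_self b)
  have hWdet : W.det = V.det⁻¹ * c := by
    rw [hW, det_add_vecMulVec hV.inv.det_pos.ne'.isUnit,
      nonsing_inv_nonsing_inv _ hVd.ne'.isUnit, det_nonsing_inv, Ring.inverse_eq_inv', hc]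
  set r := ξ.ofLp - M *ᵥ b with hr
  set N := M + c⁻¹ • vecMulVec r (V *ᵥ b) with hN
  have hm : Measurable fun A : Matrix (Fin p) (Fin q) ℝ => ENNReal.ofReal
      (Real.exp (-(1 / 2) * ((A - N)ᵀ * S⁻¹ * (A - N) * W).trace)) :=
    (Continuous.measurable (by fun_prop)).ennreal_ofReal
  set K := 1 / ((2 * Real.pi) ^ ((p : ℝ) / 2) * S.det ^ (1 / 2 : ℝ)) *
    (1 / ((2 * Real.pi) ^ ((p : ℝ) * (q : ℝ) / 2) * V.det ^ ((p : ℝ) / 2) *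
      S.det ^ ((q : ℝ) / 2))) * Real.exp (-(1 / 2) * (c⁻¹ * (r ⬝ᵥ (S⁻¹ *ᵥ r)))) with hK
  have hK0 : 0 < K := by positivity
  have h1 : ∀ A : Matrix (Fin p) (Fin q) ℝ,
      normalPDF (WithLp.toLp 2 (A *ᵥ b)) S ξ * matrixNormalPDF M S V A =
      K * Real.exp (-(1 / 2) * ((A - N)ᵀ * S⁻¹ * (A - N) * W).trace) := by
    intro A
    have h2 := quadForm_add_trace hST hV b r hc hc0.ne' (A - M)
    have h3 : (ξ - WithLp.toLp 2 (A *ᵥ b)).ofLp = r - (A - M) *ᵥ b := by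
      rw [hr, sub_mulVec]
      simp
    have h4 : A - M - c⁻¹ • vecMulVec r (V *ᵥ b) = A - N := by rw [hN, sub_sub]
    rw [h4, ← hW] at h2
    rw [normalPDF, matrixNormalPDF, h3, hK, mul_mul_mul_comm, ← Real.exp_add, ← mul_add, h2,
      mul_add, Real.exp_add]
    ring
  rw [lintegral_congr fun A => by rw [h1 A, ENNReal.ofReal_mul hK0.le], lintegral_const_mul _ hm]
  have h5 := lintegral_exp_neg_trace hS hWp.inv N
  rw [nonsing_inv_nonsing_inv _ hWp.det_pos.ne'.isUnit] at h5
  rw [h5, ← ENNReal.ofReal_mul hK0.le, hK, det_nonsing_inv, Ring.inverse_eq_inv', hWdet, mul_inv,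
    inv_inv, Real.mul_rpow hVd.le (inv_pos.2 hc0).le, Real.inv_rpow hc0.le,
    Real.mul_rpow (by positivity) hc0.le]
  congr 1
  field_simp

/-! ### The prior and the predictive density -/

instance : SFinite (paramLebesgue p q) := by
  unfold paramLebesgue; infer_instance

theorem measurable_normalPDF (b : Fin q → ℝ) :
    Measurable fun x : (Matrix (Fin p) (Fin q) ℝ × Matrix (Fin p) (Fin p) ℝ) ×
      EuclideanSpace ℝ (Fin p) => normalPDF (WithLp.toLp 2 (x.1.1 *ᵥ b)) x.1.2 x.2 := by
  have h1 : Measurable fun x : (Matrix (Fin p) (Fin q) ℝ × Matrix (Fin p) (Fin p) ℝ) ×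
      EuclideanSpace ℝ (Fin p) => x.1.2.det := measurable_matrix_det.comp (by fun_prop)
  have h2 : Continuous fun y : Matrix (Fin p) (Fin q) ℝ × Matrix (Fin p) (Fin p) ℝ ×
      EuclideanSpace ℝ (Fin p) => (y.2.2 - WithLp.toLp 2 (y.1 *ᵥ b)).ofLp ⬝ᵥ
        (y.2.1 *ᵥ (y.2.2 - WithLp.toLp 2 (y.1 *ᵥ b)).ofLp) := by fun_prop
  have h3 := h2.measurable.comp (f := fun x : (Matrix (Fin p) (Fin q) ℝ ×
    Matrix (Fin p) (Fin p) ℝ) × EuclideanSpace ℝ (Fin p) => (x.1.1, x.1.2⁻¹, x.2))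
    (measurable_fst.fst.prodMk ((measurable_matrix_inv.comp measurable_fst.snd).prodMk
      measurable_snd))
  simp only [Function.comp_def] at h3
  unfold normalPDF
  exact ((h1.pow_const _).const_mul _).const_div _ |>.mul (h3.const_mul _).exp

theorem inverseWishartPDF_eq (Ψ : Matrix (Fin p) (Fin p) ℝ) (ν : ℝ)
    (S : Matrix (Fin p) (Fin p) ℝ) :
    inverseWishartPDF Ψ ν S = Ψ.det ^ (ν / 2) / (2 ^ (ν * (p : ℝ) / 2) *
      multivariateGamma p (ν / 2)) * inverseWishartKernel Ψ ν S := by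
  unfold inverseWishartPDF inverseWishartKernel
  split_ifs
  · ring
  · simp

theorem measurable_inverseWishartPDF (Ψ : Matrix (Fin p) (Fin p) ℝ) (ν : ℝ) :
    Measurable (inverseWishartPDF Ψ ν) := by
  rw [funext (inverseWishartPDF_eq Ψ ν)]
  exact (measurable_inverseWishartKernel Ψ ν).const_mul _

theorem inverseWishartKernel_nonneg (Ψ : Matrix (Fin p) (Fin p) ℝ) (ν : ℝ)
    (S : Matrix (Fin p) (Fin p) ℝ) : 0 ≤ inverseWishartKernel Ψ ν S := by
  unfold inverseWishartKernel
  split_ifs with h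
  · have := h.det_pos
    positivity
  · rfl

variable {M : Matrix (Fin p) (Fin q) ℝ} {V : Matrix (Fin q) (Fin q) ℝ}
  {Ψ : Matrix (Fin p) (Fin p) ℝ} {ν : ℝ}

theorem inverseWishartPDF_nonneg (hΨ : Ψ.PosDef) (hν : (p : ℝ) - 1 < ν)
    (S : Matrix (Fin p) (Fin p) ℝ) : 0 ≤ inverseWishartPDF Ψ ν S := by
  have h1 := hΨ.det_pos
  have h2 : 0 < multivariateGamma p (ν / 2) := multivariateGamma_pos (by linarith)
  have h3 := inverseWishartKernel_nonneg Ψ ν S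
  rw [inverseWishartPDF_eq]
  positivity

theorem inverseWishartPDF_of_not_posDef {S : Matrix (Fin p) (Fin p) ℝ} (hS : ¬ S.PosDef) :
    inverseWishartPDF Ψ ν S = 0 := if_neg hS

theorem measurable_mniwPDF (M : Matrix (Fin p) (Fin q) ℝ) (V : Matrix (Fin q) (Fin q) ℝ)
    (Ψ : Matrix (Fin p) (Fin p) ℝ) (ν : ℝ) : Measurable (mniwPDF M V Ψ ν) := by
  have h1 : Measurable fun x : Matrix (Fin p) (Fin q) ℝ × Matrix (Fin p) (Fin p) ℝ => x.2.det :=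
    measurable_matrix_det.comp measurable_snd
  have h2 : Continuous fun y : Matrix (Fin p) (Fin q) ℝ × Matrix (Fin p) (Fin p) ℝ =>
      ((y.1 - M)ᵀ * y.2 * (y.1 - M) * V⁻¹).trace := by fun_prop
  have h3 := h2.measurable.comp
    (f := fun x : Matrix (Fin p) (Fin q) ℝ × Matrix (Fin p) (Fin p) ℝ => (x.1, x.2⁻¹))
    (measurable_fst.prodMk (measurable_matrix_inv.comp measurable_snd))
  simp only [Function.comp_def] at h3
  unfold mniwPDF matrixNormalPDF
  exact (((h1.pow_const _).const_mul _).const_div _ |>.mul (h3.const_mul _).exp).mul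
    ((measurable_inverseWishartPDF Ψ ν).comp measurable_snd)

theorem mniwPDF_nonneg (hV : V.PosDef) (hΨ : Ψ.PosDef) (hν : (p : ℝ) - 1 < ν)
    (θ : Matrix (Fin p) (Fin q) ℝ × Matrix (Fin p) (Fin p) ℝ) : 0 ≤ mniwPDF M V Ψ ν θ := by
  by_cases hS : θ.2.PosDef
  · have h1 := hS.det_pos
    have h2 := hV.det_pos
    have h3 := inverseWishartPDF_nonneg hΨ hν θ.2
    unfold mniwPDF matrixNormalPDF
    positivity
  · rw [mniwPDF, inverseWishartPDF_of_not_posDef hS, mul_zero]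

theorem normalPDF_mul_mniwPDF_nonneg (hV : V.PosDef) (hΨ : Ψ.PosDef) (hν : (p : ℝ) - 1 < ν)
    (m ξ : EuclideanSpace ℝ (Fin p))
    (θ : Matrix (Fin p) (Fin q) ℝ × Matrix (Fin p) (Fin p) ℝ) :
    0 ≤ normalPDF m θ.2 ξ * mniwPDF M V Ψ ν θ := by
  by_cases hS : θ.2.PosDef
  · have h1 := hS.det_pos
    have h2 := mniwPDF_nonneg (M := M) hV hΨ hν θ
    unfold normalPDF
    positivity
  · rw [mniwPDF, inverseWishartPDF_of_not_posDef hS, mul_zero, mul_zero]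

theorem isProbabilityMeasure_mniw (hV : V.PosDef) (hΨ : Ψ.PosDef) (hν : (p : ℝ) - 1 < ν) :
    IsProbabilityMeasure (mniw M V Ψ ν) := by
  have hΨd := hΨ.det_pos
  have hG : 0 < multivariateGamma p (ν / 2) := multivariateGamma_pos (by linarith)
  refine ⟨?_⟩
  have hm := (measurable_mniwPDF M V Ψ ν).ennreal_ofReal
  rw [mniw, withDensity_apply _ .univ, Measure.restrict_univ, paramLebesgue,
    lintegral_prod_symm _ hm.aemeasurable]
  have h1 : ∀ S : Matrix (Fin p) (Fin p) ℝ,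
      ∫⁻ A, ENNReal.ofReal (mniwPDF M V Ψ ν (A, S)) ∂matrixLebesgue p q =
        ENNReal.ofReal (Ψ.det ^ (ν / 2) / (2 ^ (ν * (p : ℝ) / 2) * multivariateGamma p (ν / 2))) *
          ENNReal.ofReal (inverseWishartKernel Ψ ν S) := by
    intro S
    rw [← ENNReal.ofReal_mul (by positivity), ← inverseWishartPDF_eq]
    by_cases hS : S.PosDef
    · simp only [mniwPDF]
      rw [lintegral_congr fun A => ENNReal.ofReal_mul' (inverseWishartPDF_nonneg hΨ hν S),
        lintegral_mul_const' _ _ ENNReal.ofReal_ne_top, lintegral_matrixNormalPDF hS hV, one_mul]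
    · simp [mniwPDF, inverseWishartPDF_of_not_posDef hS]
  rw [lintegral_congr h1, lintegral_const_mul _
    (measurable_inverseWishartKernel Ψ ν).ennreal_ofReal, lintegral_inverseWishartKernel hΨ hν,
    ← ENNReal.ofReal_mul (by positivity), Real.rpow_neg hΨd.le, ← ENNReal.ofReal_one]
  congr 1
  field_simp

/-- Integrating out the regression matrix and then the covariance. In the second step the normal
factor turns the inverse Wishart kernel with parameters `Ψ, ν` into the one with parameters
`Ψ + c⁻¹ r rᵀ, ν + 1`, where `r = ξ - M b`. -/
theorem lintegral_normalPDF_mul_mniwPDF (hV : V.PosDef) (hΨ : Ψ.PosDef) (hν : (p : ℝ) - 1 < ν)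
    (b : Fin q → ℝ) {c : ℝ} (hc : c = 1 + b ⬝ᵥ (V *ᵥ b)) (ξ : EuclideanSpace ℝ (Fin p)) :
    ∫⁻ θ, ENNReal.ofReal (normalPDF (WithLp.toLp 2 (θ.1 *ᵥ b)) θ.2 ξ * mniwPDF M V Ψ ν θ)
        ∂paramLebesgue p q =
      ENNReal.ofReal (studentTPDF (ν - (p : ℝ) + 1) (WithLp.toLp 2 (M *ᵥ b))
        ((c / (ν - (p : ℝ) + 1)) • Ψ) ξ) := by
  have hΨd := hΨ.det_pos
  have hc0 : 0 < c := by
    have := (posSemidef_iff_dotProduct_mulVec.1 hV.posSemidef).2 b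
    simp only [star_trivial] at this
    linarith
  have hρ : 0 < ν - (p : ℝ) + 1 := by linarith
  have hG : 0 < multivariateGamma p (ν / 2) := multivariateGamma_pos (by linarith)
  have hm := ((measurable_normalPDF (p := p) b).comp (f := fun θ => (θ, ξ)) (by fun_prop)).mul
    (measurable_mniwPDF M V Ψ ν)
  simp only [Pi.mul_def, Function.comp_def] at hm
  rw [paramLebesgue, lintegral_prod_symm _ hm.ennreal_ofReal.aemeasurable]
  set r := ξ.ofLp - M *ᵥ b with hr
  have hΨ' : (Ψ + vecMulVec (c⁻¹ • r) r).PosDef := by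
    rw [smul_vecMulVec]
    exact hΨ.add_posSemidef ((posSemidef_vecMulVec_self r).smul (inv_pos.2 hc0).le)
  set K := 1 / (2 * Real.pi * c) ^ ((p : ℝ) / 2) *
    (Ψ.det ^ (ν / 2) / (2 ^ (ν * (p : ℝ) / 2) * multivariateGamma p (ν / 2))) with hK
  have hK0 : 0 < K := by positivity
  have h1 : ∀ S : Matrix (Fin p) (Fin p) ℝ, ∫⁻ A, ENNReal.ofReal
      (normalPDF (WithLp.toLp 2 (A *ᵥ b)) S ξ * mniwPDF M V Ψ ν (A, S)) ∂matrixLebesgue p q =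
      ENNReal.ofReal K *
        ENNReal.ofReal (inverseWishartKernel (Ψ + vecMulVec (c⁻¹ • r) r) (ν + 1) S) := by
    intro S
    by_cases hS : S.PosDef
    · have hSd := hS.det_pos
      simp only [mniwPDF, ← mul_assoc]
      rw [lintegral_congr fun A => ENNReal.ofReal_mul' (inverseWishartPDF_nonneg hΨ hν S),
        lintegral_mul_const' _ _ ENNReal.ofReal_ne_top,
        lintegral_normalPDF_mul_matrixNormalPDF hS hV M b ξ hc,
        ← ENNReal.ofReal_mul (by positivity), ← ENNReal.ofReal_mul hK0.le, inverseWishartPDF_eq, inverseWishartKernel, if_pos hS,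
        inverseWishartKernel, if_pos hS, ← hr]
      congr 1
      have h2 : (S⁻¹ * (Ψ + vecMulVec (c⁻¹ • r) r)).trace =
          (S⁻¹ * Ψ).trace + c⁻¹ * (r ⬝ᵥ (S⁻¹ *ᵥ r)) := by
        rw [smul_vecMulVec, Matrix.mul_add, trace_add, Matrix.mul_smul, trace_smul, mul_vecMulVec,
          trace_vecMulVec, dotProduct_comm, smul_eq_mul]
      -- the factor `|S| ^ (-1 / 2)` of the normal density raises `ν` by one
      have h3 : S.det ^ (-((p : ℝ) + ν + 1) / 2) =
          S.det ^ (-((p : ℝ) + (ν + 1) + 1) / 2) * S.det ^ (1 / 2 : ℝ) := by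
        rw [← Real.rpow_add hSd]
        ring_nf
      rw [h2, mul_add, Real.exp_add, h3, hK]
      field_simp
    · simp [mniwPDF, inverseWishartPDF_of_not_posDef hS, inverseWishartKernel, hS]
  rw [lintegral_congr h1,
    lintegral_const_mul _ (measurable_inverseWishartKernel _ _).ennreal_ofReal,
    lintegral_inverseWishartKernel hΨ' (by linarith), ← ENNReal.ofReal_mul hK0.le]
  congr 1
  have hdet : (Ψ + vecMulVec (c⁻¹ • r) r).det = Ψ.det * (1 + c⁻¹ * (r ⬝ᵥ (Ψ⁻¹ *ᵥ r))) := by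
    rw [det_add_vecMulVec hΨd.ne'.isUnit, mulVec_smul, dotProduct_smul, smul_eq_mul]
  have hQ : 0 ≤ r ⬝ᵥ (Ψ⁻¹ *ᵥ r) := by
    simpa using (posSemidef_iff_dotProduct_mulVec.1 hΨ.inv.posSemidef).2 r
  -- the ratio `Γ_p((ν + 1) / 2) / Γ_p(ν / 2)` is a ratio of two values of `Γ`
  have hgam := multivariateGamma_add_half p (ν / 2)
  have e1 : ν / 2 + 1 / 2 = (ν + 1) / 2 := by ring
  have e2 : ν / 2 + (1 - (p : ℝ)) / 2 = (ν - (p : ℝ) + 1) / 2 := by ring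
  rw [e1, e2] at hgam
  have hg1 : 0 < Real.Gamma ((ν - (p : ℝ) + 1) / 2) := Real.Gamma_pos_of_pos (by linarith)
  have hinv : ((c / (ν - (p : ℝ) + 1)) • Ψ)⁻¹ = ((ν - (p : ℝ) + 1) / c) • Ψ⁻¹ := by
    have := invertibleOfNonzero (div_pos hc0 hρ).ne'
    rw [inv_smul _ _ hΨd.ne'.isUnit, invOf_eq_inv, inv_div]
  have hz : (ξ - WithLp.toLp 2 (M *ᵥ b)).ofLp = r := by simp [hr]
  rw [studentTPDF, hz, hinv, det_smul, Fintype.card_fin, hdet, smul_mulVec, dotProduct_smul,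
    smul_eq_mul, hK]
  set ρ := ν - (p : ℝ) + 1 with hρdef
  have e3 : ρ + (p : ℝ) = ν + 1 := by rw [hρdef]; ring
  have e4 : 1 + 1 / ρ * (ρ / c * (r ⬝ᵥ (Ψ⁻¹ *ᵥ r))) = 1 + c⁻¹ * (r ⬝ᵥ (Ψ⁻¹ *ᵥ r)) := by
    field_simp
  have hB : 0 < 1 + c⁻¹ * (r ⬝ᵥ (Ψ⁻¹ *ᵥ r)) := by positivity
  rw [e3, e4]
  set B := 1 + c⁻¹ * (r ⬝ᵥ (Ψ⁻¹ *ᵥ r)) with hBdef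
  have e5 : ((c / ρ) ^ p * Ψ.det) ^ (1 / 2 : ℝ) =
      c ^ ((p : ℝ) / 2) / ρ ^ ((p : ℝ) / 2) * Ψ.det ^ (1 / 2 : ℝ) := by
    rw [Real.mul_rpow (pow_pos (div_pos hc0 hρ) p).le hΨd.le, ← Real.rpow_natCast,
      ← Real.rpow_mul (div_pos hc0 hρ).le, Real.div_rpow hc0.le hρ.le]
    ring_nf
  have e6 : (2 : ℝ) ^ ((ν + 1) * (p : ℝ) / 2) = 2 ^ (ν * (p : ℝ) / 2) * 2 ^ ((p : ℝ) / 2) := by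
    rw [← Real.rpow_add two_pos]
    ring_nf
  have e7 : Ψ.det ^ (-((ν + 1) / 2)) = (Ψ.det ^ (ν / 2) * Ψ.det ^ (1 / 2 : ℝ))⁻¹ := by
    rw [← Real.rpow_add hΨd, Real.rpow_neg hΨd.le]
    ring_nf
  have e8 : Real.Gamma ((ν + 1) / 2) = multivariateGamma p ((ν + 1) / 2) *
      Real.Gamma (ρ / 2) / multivariateGamma p (ν / 2) := by
    rw [hgam]
    field_simp
  rw [e5, e6, e8, Real.mul_rpow hΨd.le hB.le, e7, Real.mul_rpow (by positivity) hc0.le,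
    Real.mul_rpow two_pos.le Real.pi_pos.le, neg_div]
  field_simp

/-! ### The predictive law and its mean -/

theorem normalPDF_eq_centredNormalPDF (m : EuclideanSpace ℝ (Fin p))
    (S : Matrix (Fin p) (Fin p) ℝ) (z : EuclideanSpace ℝ (Fin p)) :
    normalPDF m S z = centredNormalPDF S (z - m).ofLp := by
  rw [normalPDF, centredNormalPDF, Fintype.card_fin]

/-- The prior is concentrated on positive definite `Σ`, so the values of `multivariateGaussian` at
other matrices are irrelevant. -/
theorem ae_mniw_posDef : ∀ᵐ θ ∂mniw M V Ψ ν, θ.2.PosDef := by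
  rw [mniw, ae_withDensity_iff (measurable_mniwPDF M V Ψ ν).ennreal_ofReal]
  refine .of_forall fun θ h => ?_
  by_contra hS
  simp [mniwPDF, inverseWishartPDF_of_not_posDef hS] at h

/-- The normal densities form a measurable family of measures. Measurability of
`multivariateGaussian` in its covariance, which is defined through a matrix square root, is then
inherited almost everywhere. -/
theorem measurable_withDensity_normalPDF (b : Fin q → ℝ) :
    Measurable fun θ : Matrix (Fin p) (Fin q) ℝ × Matrix (Fin p) (Fin p) ℝ =>
      (volume : Measure (EuclideanSpace ℝ (Fin p))).withDensity fun z =>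
        ENNReal.ofReal (normalPDF (WithLp.toLp 2 (θ.1 *ᵥ b)) θ.2 z) := by
  refine Measure.measurable_of_measurable_coe _ fun s hs => ?_
  simp only [withDensity_apply _ hs]
  exact (measurable_normalPDF b).ennreal_ofReal.lintegral_prod_right'

theorem multivariateGaussian_ae_eq_withDensity (b : Fin q → ℝ) :
    (fun θ => multivariateGaussian (WithLp.toLp 2 (θ.1 *ᵥ b)) θ.2) =ᵐ[mniw M V Ψ ν]
      fun θ => volume.withDensity fun z =>
        ENNReal.ofReal (normalPDF (WithLp.toLp 2 (θ.1 *ᵥ b)) θ.2 z) := by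
  filter_upwards [ae_mniw_posDef] with θ hθ
  simp only [normalPDF_eq_centredNormalPDF]
  exact multivariateGaussian_eq_withDensity _ hθ

theorem aemeasurable_multivariateGaussian (b : Fin q → ℝ) :
    AEMeasurable (fun θ => multivariateGaussian (WithLp.toLp 2 (θ.1 *ᵥ b)) θ.2)
      (mniw M V Ψ ν) :=
  ⟨_, measurable_withDensity_normalPDF b, multivariateGaussian_ae_eq_withDensity b⟩

theorem isProbabilityMeasure_predictiveLaw (hV : V.PosDef) (hΨ : Ψ.PosDef)
    (hν : (p : ℝ) - 1 < ν) (b : Fin q → ℝ) :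
    IsProbabilityMeasure (predictiveLaw M V Ψ ν b) := by
  have := isProbabilityMeasure_mniw (M := M) hV hΨ hν
  refine ⟨?_⟩
  rw [predictiveLaw, Measure.bind_apply .univ (aemeasurable_multivariateGaussian b)]
  simp

theorem predictiveLaw_eq_withDensity (hV : V.PosDef) (hΨ : Ψ.PosDef) (hν : (p : ℝ) - 1 < ν)
    (b : Fin q → ℝ) :
    predictiveLaw M V Ψ ν b = volume.withDensity fun ξ => ∫⁻ θ, ENNReal.ofReal
      (normalPDF (WithLp.toLp 2 (θ.1 *ᵥ b)) θ.2 ξ * mniwPDF M V Ψ ν θ) ∂paramLebesgue p q := by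
  have hmd := (measurable_mniwPDF M V Ψ ν).ennreal_ofReal
  ext s hs
  have hms := (Measure.measurable_coe hs).comp
    (measurable_withDensity_normalPDF (p := p) b)
  simp only [Function.comp_def] at hms
  rw [predictiveLaw, Measure.bind_apply hs (aemeasurable_multivariateGaussian b),
    withDensity_apply _ hs, lintegral_congr_ae ((multivariateGaussian_ae_eq_withDensity b).mono
      fun θ hθ => congrArg (fun m : Measure _ => m s) hθ), mniw,
    lintegral_withDensity_eq_lintegral_mul _ hmd hms]
  have h1 : ∀ θ : Matrix (Fin p) (Fin q) ℝ × Matrix (Fin p) (Fin p) ℝ,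
      ENNReal.ofReal (mniwPDF M V Ψ ν θ) * (volume.withDensity fun z =>
        ENNReal.ofReal (normalPDF (WithLp.toLp 2 (θ.1 *ᵥ b)) θ.2 z)) s =
      ∫⁻ ξ in s, ENNReal.ofReal
        (normalPDF (WithLp.toLp 2 (θ.1 *ᵥ b)) θ.2 ξ * mniwPDF M V Ψ ν θ) := by
    intro θ
    rw [lintegral_congr fun ξ => ENNReal.ofReal_mul' (mniwPDF_nonneg hV hΨ hν θ),
      lintegral_mul_const' _ _ ENNReal.ofReal_ne_top, withDensity_apply _ hs, mul_comm]
  simp only [Pi.mul_apply]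
  rw [lintegral_congr h1, lintegral_lintegral_swap]
  exact ((measurable_normalPDF b).mul
    ((measurable_mniwPDF M V Ψ ν).comp measurable_fst)).ennreal_ofReal.aemeasurable

open scoped MatrixOrder in
/-- A positive definite form dominates a multiple of the squared norm, as `Q = R²` with `R`
injective, hence bounded below. -/
theorem exists_mul_norm_sq_le_quadForm {Q : Matrix (Fin p) (Fin p) ℝ} (hQ : Q.PosDef) :
    ∃ ε : ℝ, 0 < ε ∧ ∀ z : EuclideanSpace ℝ (Fin p), ε * ‖z‖ ^ 2 ≤ z.ofLp ⬝ᵥ (Q *ᵥ z.ofLp) := by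
  obtain ⟨hsymm, hRR, hR0⟩ := hQ.sqrt_spec
  set R := CFC.sqrt Q with hR
  have hker : LinearMap.ker (toEuclideanCLM (𝕜 := ℝ) R : EuclideanSpace ℝ (Fin p) →ₗ[ℝ]
      EuclideanSpace ℝ (Fin p)) = ⊥ := by
    refine LinearMap.ker_eq_bot'.2 fun z hz => ?_
    have h1 : R *ᵥ z.ofLp = 0 := by
      rw [← ofLp_toEuclideanCLM (𝕜 := ℝ)]
      exact congrArg WithLp.ofLp hz
    have h2 := congrArg (R⁻¹ *ᵥ ·) h1
    simp only [mulVec_mulVec, nonsing_inv_mul _ hR0, one_mulVec, mulVec_zero] at h2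
    exact WithLp.ofLp_injective 2 h2
  obtain ⟨K, hK, hanti⟩ := LinearMap.exists_antilipschitzWith _ hker
  have hK' : (0 : ℝ) < K := hK
  refine ⟨((K : ℝ) ^ 2)⁻¹, by positivity, fun z => ?_⟩
  have h1 : ‖z‖ ≤ K * ‖toEuclideanCLM (𝕜 := ℝ) R z‖ := by
    simpa using hanti.le_mul_dist z 0
  have h2 : ‖toEuclideanCLM (𝕜 := ℝ) R z‖ ^ 2 = z.ofLp ⬝ᵥ (Q *ᵥ z.ofLp) := by
    rw [EuclideanSpace.real_norm_sq_eq, ofLp_toEuclideanCLM, ← hRR, ← mulVec_mulVec,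
      dotProduct_mulVec, ← mulVec_transpose, hsymm]
    simp [dotProduct, sq]
  rw [← h2, inv_mul_le_iff₀ (by positivity), ← mul_pow]
  gcongr

theorem studentTPDF_nonneg {ρ : ℝ} (hρ : 0 < ρ) (μ : EuclideanSpace ℝ (Fin p))
    {Λ : Matrix (Fin p) (Fin p) ℝ} (hΛ : Λ.PosDef) (z : EuclideanSpace ℝ (Fin p)) :
    0 ≤ studentTPDF ρ μ Λ z := by
  have h1 := hΛ.det_pos
  have h2 : 0 ≤ (z - μ).ofLp ⬝ᵥ (Λ⁻¹ *ᵥ (z - μ).ofLp) := by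
    simpa using (posSemidef_iff_dotProduct_mulVec.1 hΛ.inv.posSemidef).2 (z - μ).ofLp
  have h3 : 0 < Real.Gamma ((ρ + (p : ℝ)) / 2) := Real.Gamma_pos_of_pos (by positivity)
  have h4 : 0 < Real.Gamma (ρ / 2) := Real.Gamma_pos_of_pos (by positivity)
  unfold studentTPDF
  positivity

theorem measurable_studentTPDF (ρ : ℝ) (μ : EuclideanSpace ℝ (Fin p))
    (Λ : Matrix (Fin p) (Fin p) ℝ) : Measurable (studentTPDF ρ μ Λ) := by
  have : Continuous fun z : EuclideanSpace ℝ (Fin p) =>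
    (z - μ).ofLp ⬝ᵥ (Λ⁻¹ *ᵥ (z - μ).ofLp) := by fun_prop
  unfold studentTPDF
  fun_prop

/-- The density is at most a multiple of `(1 + ‖ξ - μ‖²) ^ (-(ρ + p) / 2)`, which stays integrable
after multiplication by `‖ξ - μ‖` exactly because `ρ > 1`. -/
theorem integrable_sub_studentT {ρ : ℝ} (hρ : 1 < ρ) (μ : EuclideanSpace ℝ (Fin p))
    {Λ : Matrix (Fin p) (Fin p) ℝ} (hΛ : Λ.PosDef) :
    Integrable (fun ξ => ξ - μ) (studentT ρ μ Λ) := by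
  have hΛd := hΛ.det_pos
  have hp : (0 : ℝ) ≤ p := p.cast_nonneg
  obtain ⟨ε, hε, hle⟩ := exists_mul_norm_sq_le_quadForm hΛ.inv
  set K := Real.Gamma ((ρ + (p : ℝ)) / 2) /
      (Real.Gamma (ρ / 2) * ρ ^ ((p : ℝ) / 2) * Real.pi ^ ((p : ℝ) / 2) *
        Λ.det ^ (1 / 2 : ℝ)) with hK
  have h3 : 0 < Real.Gamma ((ρ + (p : ℝ)) / 2) := Real.Gamma_pos_of_pos (by positivity)
  have h4 : 0 < Real.Gamma (ρ / 2) := Real.Gamma_pos_of_pos (by positivity)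
  have hK0 : 0 < K := by positivity
  -- `1 + (ε / ρ) t ≥ min 1 (ε / ρ) (1 + t)` for `t ≥ 0`
  set δ := min 1 (ε / ρ) with hδ
  have hδ0 : 0 < δ := lt_min one_pos (by positivity)
  have hint := ((integrable_rpow_neg_one_add_norm_sq (μ := volume)
    (E := EuclideanSpace ℝ (Fin p)) (r := ρ + p - 1) (by simp; linarith)).const_mul
    (K * δ ^ (-(ρ + (p : ℝ)) / 2))).comp_sub_right μ
  rw [studentT, integrable_withDensity_iff_integrable_smul'
    (measurable_studentTPDF ρ μ Λ).ennreal_ofReal (by simp)]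
  refine hint.mono' ?_ (.of_forall fun ξ => ?_)
  · have := measurable_studentTPDF ρ μ Λ
    exact Measurable.aestronglyMeasurable (by fun_prop)
  · rw [ENNReal.toReal_ofReal (studentTPDF_nonneg (by linarith) μ hΛ ξ), norm_smul,
      Real.norm_of_nonneg (studentTPDF_nonneg (by linarith) μ hΛ ξ), studentTPDF, ← hK]
    set z := ξ - μ
    have hz : 0 < 1 + ‖z‖ ^ 2 := by positivity
    have h5 : δ * (1 + ‖z‖ ^ 2) ≤ 1 + 1 / ρ * (z.ofLp ⬝ᵥ (Λ⁻¹ *ᵥ z.ofLp)) := by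
      have h6 : ε / ρ * ‖z‖ ^ 2 ≤ 1 / ρ * (z.ofLp ⬝ᵥ (Λ⁻¹ *ᵥ z.ofLp)) := by
        have := mul_le_mul_of_nonneg_left (hle z) (by positivity : 0 ≤ 1 / ρ)
        calc _ = 1 / ρ * (ε * ‖z‖ ^ 2) := by ring
          _ ≤ _ := this
      have h7 := mul_le_mul_of_nonneg_right (min_le_right 1 (ε / ρ)) (sq_nonneg ‖z‖)
      have h8 := min_le_left 1 (ε / ρ)
      rw [mul_add, mul_one]
      linarith
    have h9 := Real.rpow_le_rpow_of_nonpos (mul_pos hδ0 hz) h5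
      (by linarith : -(ρ + (p : ℝ)) / 2 ≤ 0)
    have h10 : ‖z‖ ≤ (1 + ‖z‖ ^ 2) ^ (1 / 2 : ℝ) := by
      rw [← Real.sqrt_eq_rpow]
      exact Real.le_sqrt_of_sq_le (by linarith)
    calc _ ≤ K * (δ * (1 + ‖z‖ ^ 2)) ^ (-(ρ + (p : ℝ)) / 2) * (1 + ‖z‖ ^ 2) ^ (1 / 2 : ℝ) := by
          gcongr
      _ = _ := by
          rw [Real.mul_rpow hδ0.le hz.le, mul_assoc, mul_assoc, mul_assoc, ← Real.rpow_add hz]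
          ring_nf

theorem integral_sub_studentT (ρ : ℝ) (μ : EuclideanSpace ℝ (Fin p))
    (Λ : Matrix (Fin p) (Fin p) ℝ) :
    ∫ ξ, (ξ - μ) ∂studentT ρ μ Λ = 0 := by
  rw [studentT, integral_withDensity_eq_integral_toReal_smul
    (measurable_studentTPDF ρ μ Λ).ennreal_ofReal (by simp)]
  have h1 := integral_add_right_eq_self (μ := volume)
    (fun ξ => (ENNReal.ofReal (studentTPDF ρ μ Λ ξ)).toReal • (ξ - μ)) μ
  rw [← h1]
  -- the density is even about `μ`, so the integrand is odd
  have h2 := integral_neg_eq_self (μ := volume) (fun z =>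
    (ENNReal.ofReal (studentTPDF ρ μ Λ (z + μ))).toReal • (z + μ - μ))
  have h3 : ∀ z, studentTPDF ρ μ Λ (-z + μ) = studentTPDF ρ μ Λ (z + μ) := by
    intro z
    simp [studentTPDF, mulVec_neg]
  simp only [h3, add_sub_cancel_right, smul_neg, integral_neg] at h2 ⊢
  set I := ∫ z : EuclideanSpace ℝ (Fin p), (ENNReal.ofReal (studentTPDF ρ μ Λ (z + μ))).toReal • z
  have h4 : (2 : ℝ) • I = 0 := by rw [two_smul, ← sub_neg_eq_add, h2, sub_self]
  exact (smul_eq_zero.1 h4).resolve_left two_ne_zero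

end

/-! ### The Student-t predictive distribution -/

theorem theorem2 {n_x n_ξ n_φ : ℕ}
    (φ : Fin n_φ → EuclideanSpace ℝ (Fin n_x) → ℝ) (x : EuclideanSpace ℝ (Fin n_x))
    (hφ : basisVec φ x ≠ 0)
    (M : Matrix (Fin n_ξ) (Fin n_φ) ℝ) (V : Matrix (Fin n_φ) (Fin n_φ) ℝ)
    (Ψ : Matrix (Fin n_ξ) (Fin n_ξ) ℝ) (ν : ℝ)
    (hV : V.PosDef) (hΨ : Ψ.PosDef) (hν : (n_ξ : ℝ) - 1 < ν)
    (ρ κ : ℝ) (μ : EuclideanSpace ℝ (Fin n_ξ)) (Λ : Matrix (Fin n_ξ) (Fin n_ξ) ℝ)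
    (hρ : ρ = ν - (n_ξ : ℝ) + 1)
    (hμ : μ = WithLp.toLp 2 (M *ᵥ basisVec φ x))
    (hκ : κ = 1 / (basisVec φ x ⬝ᵥ (V *ᵥ basisVec φ x)))
    (hΛ : Λ = ((κ + 1) / (κ * ρ)) • Ψ) :
    -- the prior is a probability distribution
    IsProbabilityMeasure (mniw M V Ψ ν) ∧
    -- the marginal density of `ξ` is the Student-t density, at every point
    (∀ ξ : EuclideanSpace ℝ (Fin n_ξ),
      Integrable
        (fun θ : Matrix (Fin n_ξ) (Fin n_φ) ℝ × Matrix (Fin n_ξ) (Fin n_ξ) ℝ =>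
          normalPDF (WithLp.toLp 2 (θ.1 *ᵥ basisVec φ x)) θ.2 ξ * mniwPDF M V Ψ ν θ)
        (paramLebesgue n_ξ n_φ) ∧
      predictivePDF M V Ψ ν (basisVec φ x) ξ = studentTPDF ρ μ Λ ξ) ∧
    -- the marginal law of `ξ` is the Student-t distribution
    predictiveLaw M V Ψ ν (basisVec φ x) = studentT ρ μ Λ ∧
    -- its location `μ` is its mean, whenever the mean exists
    (1 < ρ → Integrable (fun ξ => ξ) (predictiveLaw M V Ψ ν (basisVec φ x)) ∧
      ∫ ξ, ξ ∂(predictiveLaw M V Ψ ν (basisVec φ x)) = μ) := by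
  set b := basisVec φ x with hb
  have hbV : 0 < b ⬝ᵥ (V *ᵥ b) := by simpa using hV.dotProduct_mulVec_pos hφ
  have hρ0 : 0 < ρ := by rw [hρ]; linarith
  have hκ0 : 0 < κ := by rw [hκ]; positivity
  have hΛp : Λ.PosDef := by
    rw [hΛ]
    exact hΨ.smul (by positivity)
  -- with `c = 1 + bᵀ V b` one has `(κ + 1) / κ = c`
  have hc : (κ + 1) / (κ * ρ) = (1 + b ⬝ᵥ (V *ᵥ b)) / ρ := by
    rw [hκ]
    field_simp
  have hdens : ∀ ξ : EuclideanSpace ℝ (Fin n_ξ), ∫⁻ θ, ENNReal.ofReal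
      (normalPDF (WithLp.toLp 2 (θ.1 *ᵥ b)) θ.2 ξ * mniwPDF M V Ψ ν θ) ∂paramLebesgue n_ξ n_φ =
      ENNReal.ofReal (studentTPDF ρ μ Λ ξ) := by
    intro ξ
    rw [lintegral_normalPDF_mul_mniwPDF hV hΨ hν b rfl ξ, hΛ, hμ, hc, hρ]
  have hlaw : predictiveLaw M V Ψ ν b = studentT ρ μ Λ := by
    rw [predictiveLaw_eq_withDensity hV hΨ hν, studentT]
    simp_rw [hdens]
  refine ⟨isProbabilityMeasure_mniw hV hΨ hν, fun ξ => ?_, hlaw, fun hρ1 => ?_⟩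
  · have hmeas := (((measurable_normalPDF b).comp (f := fun θ => (θ, ξ)) (by fun_prop)).mul
      (measurable_mniwPDF M V Ψ ν)).aestronglyMeasurable (μ := paramLebesgue n_ξ n_φ)
    have hnn := normalPDF_mul_mniwPDF_nonneg (M := M) hV hΨ hν
    constructor
    · refine (lintegral_ofReal_ne_top_iff_integrable hmeas
        (.of_forall fun θ => hnn _ ξ θ)).1 ?_
      exact (hdens ξ).trans_ne ENNReal.ofReal_ne_top
    · rw [predictivePDF, integral_eq_lintegral_of_nonneg_ae (.of_forall fun θ => hnn _ ξ θ) hmeas,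
        hdens, ENNReal.toReal_ofReal (studentTPDF_nonneg hρ0 μ hΛp ξ)]
  · have hprob := isProbabilityMeasure_predictiveLaw (M := M) hV hΨ hν b
    rw [hlaw] at hprob ⊢
    have hsub := integrable_sub_studentT hρ1 μ hΛp
    have heq : (fun ξ : EuclideanSpace ℝ (Fin n_ξ) => ξ) = fun ξ => ξ - μ + μ := by simp
    rw [heq]
    refine ⟨hsub.add (integrable_const μ), ?_⟩
    rw [integral_add hsub (integrable_const μ), integral_sub_studentT ρ μ Λ]
    simp
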